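/- **Setting.** A *rule* $r$ is $a_1\vee\dots\vee a_\ell\leftarrow a_{\ell+1},\dots,a_m,\neg a_{m+1},\dots,\neg a_n$ with pairwise distinct atoms, $0\le\ell\le m\le n$; put $H_r=\{a_1,\dots,a_\ell\}$, $B_r^+=\{a_{\ell+1},\dots,a_m\}$, $B_r^-=\{a_{m+1},\dots,a_n\}$, $\mathrm{at}(r)=H_r\cup B_r^+\cup B_r^-$. A *program* $\Pi$ is a finite set of rules, $\mathrm{at}(\Pi)=\bigcup_{r\in\Pi}\mathrm{at}(r)$. A set $I$ of atoms satisfies $r$ if $(H_r\cup B_r^-)\cap I\ne\emptyset$ or $B_r^+\setminus I\neq\emptyset$; $I\models\Pi$ ($I$ is a model of $\Pi$) if it satisfies all rules of $\Pi$. The reduct $\Pi^I$ is obtained by deleting the rules with $B_r^-\cap I\ne\emptyset$ and deleting the negative bodies of the remaining rules; $I$ is an *answer set* of $\Pi$ if it is a subset-minimal model of $\Pi^I$. $\Pi$ is *head-cycle-free* if there are no rule $r\in\Pi$ and distinct $a,b\in H_r$ lying on a common closed directed walk of the digraph with edges $(a',b')$ for $a'\in B_r^+$, $b'\in H_r$,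 $r\in\Pi$. An *instance* of #PAS is a pair $(\Pi,P)$ with $P\subseteq\mathrm{at}(\Pi)$; its *projected answer sets count* is $|\{I\cap P : I\text{ is an answer set of }\Pi\}|$. The *primal graph* $G_\Pi$ has vertex set $\mathrm{at}(\Pi)$ and an edge between any two distinct atoms of a common rule. A *tree decomposition* of a graph $(V,E)$ is a finite rooted tree with bags $\chi(t)\subseteq V$ that cover all vertices and edges and satisfy $\chi(r)\cap\chi(t)\subseteq\chi(s)$ whenever the node $s$ lies on the path from $r$ to $t$. It is *nice* if the root and leaf bags are empty and every node $t$ is a *leaf*, or has one child $t_1$ and $\chi(t)=\chi(t_1)\cup\{a\}$, $a\notin\chi(t_1)$ (*introduce*) or $\chi(t)=\chi(t_1)\setminus\{a\}$, $a\in\chi(t_1)$ (*removal*), or has two children $t_1,t_2$ and $\chi(t)=\chi(t_1)=\chi(t_2)\neq\emptyset$ (*join*). Children are ordered; let $\Pi_t=\{r\in\Pi:\mathrm{at}(r)\subseteq\chi(t)\}$. **Algorithm $\mathrm{MDP}_{\mathrm{PHC}}$** on $(\Pi,P)$ takes a nice tree decomposition of $G_\Pi$ with root $n$ and proceeds as follows.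 1. *$\mathrm{DP}_{\mathrm{PHC}}$.* Bottom-up, compute at each node $t$ (children $t_1,\dots$) a table $\tau(t)=\mathrm{PHC}(t,\langle\tau(t_1),\dots\rangle)$ of rows $\langle I,\mathcal P,\sigma\rangle$ ($I,\mathcal P$ sets of atoms, $\sigma$ a sequence of atoms): - leaf: $\{\langle\emptyset,\emptyset,\langle\rangle\rangle\}$; - introduce $a$: all $\langle J,\mathcal P\cup\mathrm{gp}(J,\sigma'),\sigma'\rangle$ with $\langle I,\mathcal P,\sigma\rangle\in\tau(t_1)$, $J\in\{I,I\cup\{a\}\}$, $J\models\Pi_t$, where $\sigma'=\sigma$ if $a\notin J$, and $\sigma'$ arises from $\sigma$ by inserting $a$ at an arbitrary position if $a\in J$; here $\mathrm{gp}(J,\sigma')$ is the set of all $c$ such that for some $r\in\Pi_t$: $c\in H_r$, $B_r^+\subseteq J$, $J\cap B_r^-=\emptyset$, $J\cap(H_r\setminus\{c\})=\emptyset$, and every $b\in B_r^+$ precedes $c$ in $\sigma'$; - remove $a$: all $\langle I\setminus\{a\},\mathcal P\setminus\{a\},\sigma-a\rangle$ with $\langle I,\mathcal P,\sigma\rangle\in\tau(t_1)$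 and ($a\in\mathcal P$ or $a\notin I$), where $\sigma-a$ deletes $a$ from $\sigma$; - join: all $\langle I,\mathcal P_1\cup\mathcal P_2,\sigma\rangle$ with $\langle I,\mathcal P_1,\sigma\rangle\in\tau(t_1)$, $\langle I,\mathcal P_2,\sigma\rangle\in\tau(t_2)$. 2. *Purging.* For a row $u$ at $t$ with children $t_1,\dots,t_\ell$, its *origins* are the sequences $\langle s_1,\dots,s_\ell\rangle\in\tau(t_1)\times\dots\times\tau(t_\ell)$ with $u\in\mathrm{PHC}(t,\langle\{s_1\},\dots,\{s_\ell\}\rangle)$; $\mathrm{orig}(t,\rho)$ is the set of origins of rows of $\rho$. Put $\nu(n)=\tau(n)$ and, top-down, let $\nu(t_i)$ be the set of all $i$-th entries of members of $\mathrm{orig}(t,\nu(t))$. 3. *$\mathrm{DP}_{\mathrm{PROJ}}$.* Bottom-up, compute $\pi(t)=\{\langle\rho,\mathrm{ipmc}(t,\rho)\rangle\}$, where $\rho$ ranges over the non-empty subsets of the equivalence classes of $\nu(t)$ under the relation $I\cap P=I'\cap P$ between rows $\langle I,\cdot,\cdot\rangle$, $\langle I',\cdot,\cdot\rangle$. Here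 $\mathrm{ipmc}(t,\rho)=1$ at leaves and otherwise $$\mathrm{ipmc}(t,\rho)=\Big|\mathrm{pmc}(t,\rho)+\sum_{\emptyset\subsetneq\varphi\subsetneq\rho}(-1)^{|\varphi|}\,\mathrm{ipmc}(t,\varphi)\Big|,\qquad \mathrm{pmc}(t,\rho)=\sum_{\emptyset\subsetneq O\subseteq\mathrm{orig}(t,\rho)}(-1)^{|O|-1}\prod_{i=1}^{\ell}\mathrm{s}\big(\pi(t_i),O_{(i)}\big),$$ with $O_{(i)}$ the set of $i$-th entries of members of $O$, and $\mathrm s(\pi(t'),\rho')=\sum_{\langle\rho',c\rangle\in\pi(t')}c$ (so $0$ if $\rho'$ is not stored). 4. *Output* $\mathrm s\big(\pi(n),\{\langle\emptyset,\emptyset,\langle\rangle\rangle\}\big)$. **Proposition.** Let $(\Pi,P)$ be an instance of #PAS such that $\Pi$ is head-cycle-free and is not the program whose only rule is the empty rule ($H_r=B_r^+=B_r^-=\emptyset$). Then $G_\Pi$ has a nice tree decomposition, and for every nice tree decomposition of $G_\Pi$ the algorithm $\mathrm{MDP}_{\mathrm{PHC}}$ outputs the projected answer sets count of $(\Pi,P)$.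 -/

import Mathlib

namespace PASP

/-! ### Answer set programs -/

/-- A disjunctive rule `a₁ ∨ ⋯ ∨ aₗ ← aₗ₊₁, …, aₘ, ¬ aₘ₊₁, …, ¬ aₙ` over pairwise distinct atoms. -/
structure Rule (α : Type*) where
  head : Finset α
  posBody : Finset α
  negBody : Finset α
  head_pos : Disjoint head posBody
  head_neg : Disjoint head negBody
  pos_neg : Disjoint posBody negBody
  deriving DecidableEq

/-- The rule without any atom. -/
def Rule.empty (α : Type*) : Rule α :=
  ⟨∅, ∅, ∅, Finset.disjoint_empty_left _, Finset.disjoint_empty_left _,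
    Finset.disjoint_empty_left _⟩

/-- A program is a finite set of rules. -/
abbrev Program (α : Type*) := Finset (Rule α)

variable {α : Type*} [DecidableEq α]

def Rule.atoms (r : Rule α) : Finset α := r.head ∪ r.posBody ∪ r.negBody

def atoms (prog : Program α) : Finset α := prog.biUnion Rule.atoms

/-- The interpretation `I` satisfies the rule `r`. -/
def Rule.Sat (I : Finset α) (r : Rule α) : Prop :=
  ((r.head ∪ r.negBody) ∩ I).Nonempty ∨ (r.posBody \ I).Nonempty

instance (I : Finset α) (r : Rule α) : Decidable (r.Sat I) := by
  unfold Rule.Sat; infer_instance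

/-- `I` is a model of the program. -/
def IsModel (prog : Program α) (I : Finset α) : Prop := ∀ r ∈ prog, r.Sat I

instance (prog : Program α) (I : Finset α) : Decidable (IsModel prog I) := by
  unfold IsModel; infer_instance

/-- The rule with its negative body removed. -/
def Rule.positivePart (r : Rule α) : Rule α :=
  ⟨r.head, r.posBody, ∅, r.head_pos, Finset.disjoint_empty_right _,
    Finset.disjoint_empty_right _⟩

/-- The Gelfond-Lifschitz reduct of the program under `I`. -/
def reduct (prog : Program α) (I : Finset α) : Program α :=
  (prog.filter fun r => Disjoint r.negBody I).image Rule.positivePart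

/-- `I` is an answer set: a (subset-)minimal model of the reduct under `I`. -/
def IsAnswerSet (prog : Program α) (I : Finset α) : Prop :=
  Minimal (IsModel (reduct prog I)) I

/-- The edge relation of the positive dependency digraph. -/
def DepEdge (prog : Program α) (a b : α) : Prop :=
  ∃ r ∈ prog, a ∈ r.posBody ∧ b ∈ r.head

/-- No two distinct atoms of one head lie on a common cycle (closed directed walk) of the positive
dependency digraph. -/
def HeadCycleFree (prog : Program α) : Prop :=
  ¬ ∃ r ∈ prog, ∃ a ∈ r.head, ∃ b ∈ r.head, a ≠ b ∧
    Relation.TransGen (DepEdge prog) a b ∧ Relation.TransGen (DepEdge prog) b a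

/-- The projected answer sets count of the program with respect to `P`: the number of sets
`I ∩ P` where `I` is an answer set. -/
noncomputable def projectedCount (prog : Program α) (P : Finset α) : ℕ :=
  Set.ncard ((fun I => I ∩ P) '' {I | IsAnswerSet prog I})

/-! ### Tabled tree decompositions -/

/-- A finite rooted ordered tree whose nodes have at most two children, where each node `t` carries
a bag `χ(t)` and a table from `β`. (Nodes of nice tree decompositions have at most two children.) -/
inductive TTree (α β : Type*) where
  | leaf (bag : Finset α) (tab : β)
  | unary (bag : Finset α) (tab : β) (child : TTree α β)
  | binary (bag : Finset α) (tab : β) (left right : TTree α β)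

namespace TTree

variable {α β ι ο : Type*}

/-- The bag of the root. -/
def bag : TTree α β → Finset α
  | leaf b _ => b
  | unary b _ _ => b
  | binary b _ _ _ => b

/-- The table of the root. -/
def tab : TTree α β → β
  | leaf _ x => x
  | unary _ x _ => x
  | binary _ x _ _ => x

/-- The sequence of subtrees rooted at the children of the root. -/
def children : TTree α β → List (TTree α β)
  | leaf _ _ => []
  | unary _ _ c => [c]
  | binary _ _ l r => [l, r]

/-- Nodes are addressed by the sequence of child indices on the way down from the root; this is the
subtree rooted at the node with the given address, if there is such a node. -/
def subtree? : TTree α β → List ℕ → Option (TTree α β)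
  | t, [] => some t
  | t, i :: p => (t.children[i]?).bind fun c => c.subtree? p

/-- The node `s` lies on the path of the tree between the nodes `r` and `t`: it is an ancestor of
(or equal to) one of them, and every common ancestor of `r` and `t` is an ancestor of `s`. -/
def OnPath (r s t : List ℕ) : Prop :=
  (s <+: r ∨ s <+: t) ∧ ∀ c, c <+: r → c <+: t → c <+: s

/-- The tree with its bags is a tree decomposition of the graph with vertex set `V` and
adjacency `G`. -/
structure IsTreeDecomposition (V : Finset α) (G : SimpleGraph α) (T : TTree α β) : Prop where
  vertices : ∀ v, v ∈ V ↔ ∃ p t, T.subtree? p = some t ∧ v ∈ t.bag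
  edges : ∀ u v, G.Adj u v → ∃ p t, T.subtree? p = some t ∧ u ∈ t.bag ∧ v ∈ t.bag
  paths : ∀ p q s tp tq ts, T.subtree? p = some tp → T.subtree? q = some tq →
    T.subtree? s = some ts → OnPath p s q → ∀ v, v ∈ tp.bag → v ∈ tq.bag → v ∈ ts.bag

/-- A node with bag `b` and exactly one child, whose bag is `b₁`, is an introduce node. -/
abbrev IsInt (b b₁ : Finset α) : Prop := b₁ ⊆ b ∧ b.card = b₁.card + 1

/-- A node with bag `b` and exactly one child, whose bag is `b₁`, is a removal node. -/
abbrev IsRem (b b₁ : Finset α) : Prop := b ⊆ b₁ ∧ b₁.card = b.card + 1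

/-- A node with bag `b` and exactly two children, with bags `b₁` and `b₂`, is a join node. -/
abbrev IsJoin (b b₁ b₂ : Finset α) : Prop := b = b₁ ∧ b = b₂ ∧ b ≠ ∅

/-- The type of the root is leaf (with an empty bag), introduce, removal or join. -/
def HasNiceType : TTree α β → Prop
  | leaf b _ => b = ∅
  | unary b _ c => IsInt b c.bag ∨ IsRem b c.bag
  | binary b _ l r => IsJoin b l.bag r.bag

/-- Every node has one of the four types, and the bags of the leaves and the root are empty. -/
def IsNice (T : TTree α β) : Prop :=
  (∀ p t, T.subtree? p = some t → t.HasNiceType) ∧ T.bag = ∅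

/-- Dynamic programming with table algorithm `A`: each node `t` gets the table
`o(t) = A(t, ⟨o(t₁), …, o(tₗ)⟩)`. The argument `t` of `A` gives access to the bag, the type and
the input table of the node. -/
def dp (A : TTree α ι → List ο → ο) : TTree α ι → TTree α ο
  | leaf b x => leaf b (A (leaf b x) [])
  | unary b x c => unary b (A (unary b x c) [(dp A c).tab]) (dp A c)
  | binary b x l r => binary b (A (binary b x l r) [(dp A l).tab, (dp A r).tab]) (dp A l) (dp A r)

end TTree

/-- The adjacency of the primal graph; its vertex set is `atoms prog`. -/
def primalGraph (prog : Program α) : SimpleGraph α where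
  Adj a b := a ≠ b ∧ ∃ r ∈ prog, a ∈ r.atoms ∧ b ∈ r.atoms
  symm := ⟨fun _ _ h => ⟨h.1.symm, h.2.imp fun _ hr => ⟨hr.1, hr.2.2, hr.2.1⟩⟩⟩
  loopless := ⟨fun _ h => h.1 rfl⟩

/-- `T` is a nice tree decomposition of the primal graph of the program. -/
def IsNiceTD {β : Type*} (prog : Program α) (T : TTree α β) : Prop :=
  T.IsTreeDecomposition (atoms prog) (primalGraph prog) ∧ T.IsNice

/-! ### The table algorithm PHC -/

/-- A row `⟨I, 𝒫, σ⟩`. -/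
structure Row (α : Type*) where
  interp : Finset α
  proven : Finset α
  order : List α
  deriving DecidableEq

abbrev Table (α : Type*) := Finset (Row α)

/-- The row `⟨∅, ∅, ⟨⟩⟩`. -/
def Row.empty (α : Type*) : Row α := ⟨∅, ∅, []⟩

/-- The bag-program for the bag `b`. -/
def bagProgram (prog : Program α) (b : Finset α) : Program α :=
  prog.filter fun r => r.atoms ⊆ b

/-- The atoms that can be proven from the interpretation `I` and the sequence `σ`;
`[b, a] <+ σ` says that `b` occurs before `a` in `σ`. -/
def gatherProof (I : Finset α) (σ : List α) (prog : Program α) : Finset α :=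
  prog.biUnion fun r => r.head.filter fun a =>
    r.posBody ⊆ I ∧ I ∩ r.negBody = ∅ ∧ I ∩ (r.head \ {a}) = ∅ ∧
      ∀ b ∈ r.posBody, [b, a].Sublist σ

/-- The sequences obtained from `σ` by inserting an atom of `A` at some position, and `σ` itself
if `A` is empty. -/
def possOrd (σ : List α) (A : Finset α) : Finset (List α) :=
  (if A = ∅ then {σ} else ∅) ∪
    A.biUnion fun a => (Finset.range (σ.length + 1)).image fun i => σ.insertIdx i a

/-- Introduce node with bag-program `progt` and introduced atom `a`. -/
def phcInt (progt : Program α) (a : α) (τ₁ : Table α) : Table α :=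
  τ₁.biUnion fun u =>
    (({u.interp, insert a u.interp} : Finset (Finset α)).filter fun J => IsModel progt J).biUnion
      fun J => (possOrd u.order ({a} ∩ J)).image
        fun σ => ⟨J, u.proven ∪ gatherProof J σ progt, σ⟩

/-- Removal node with removed atom `a`. -/
def phcRem (a : α) (τ₁ : Table α) : Table α :=
  (τ₁.filter fun u => a ∈ u.proven ∪ ({a} \ u.interp)).image
    fun u => ⟨u.interp.erase a, u.proven.erase a, u.order.erase a⟩

/-- Join node. -/
def phcJoin (τ₁ τ₂ : Table α) : Table α :=
  ((τ₁ ×ˢ τ₂).filter fun p => p.1.interp = p.2.interp ∧ p.1.order = p.2.order).image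
    fun p => ⟨p.1.interp, p.1.proven ∪ p.2.proven, p.1.order⟩

/-- The table algorithm PHC at the root of `t`, given the tables of the children. The introduced
(removed) atom is the only element of `b \ c.bag` (of `c.bag \ b`). -/
def phc {ι : Type*} (prog : Program α) : TTree α ι → List (Table α) → Table α
  | .leaf _ _, [] => {Row.empty α}
  | .unary b _ c, [τ₁] =>
    if TTree.IsInt b c.bag then (b \ c.bag).biUnion fun a => phcInt (bagProgram prog b) a τ₁
    else if TTree.IsRem b c.bag then (c.bag \ b).biUnion fun a => phcRem a τ₁
    else ∅
  | .binary b _ l r, [τ₁, τ₂] =>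
    if TTree.IsJoin b l.bag r.bag then phcJoin τ₁ τ₂ else ∅
  | _, _ => ∅

/-- `DP_PHC`: computes the tabled tree decomposition `(T, χ, τ)`. -/
def dpPHC {ι : Type*} (prog : Program α) : TTree α ι → TTree α (Table α) :=
  TTree.dp (phc prog)

/-! ### Origins and purging -/

/-- The set `τ₁ × ⋯ × τₗ` of sequences of rows. -/
def rowSeqs : List (Table α) → Finset (List (Row α))
  | [] => {[]}
  | τ :: τs => (τ ×ˢ rowSeqs τs).image fun p => p.1 :: p.2

/-- The originating rows of the row `u` at the root of `t`, with respect to the tables stored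
in `t`. -/
def orig (prog : Program α) (t : TTree α (Table α)) (u : Row α) : Finset (List (Row α)) :=
  (rowSeqs (t.children.map TTree.tab)).filter fun s => u ∈ phc prog t (s.map fun v => {v})

/-- The origins of a table. -/
def origs (prog : Program α) (t : TTree α (Table α)) (ρ : Table α) : Finset (List (Row α)) :=
  ρ.biUnion (orig prog t)

/-- The set of `i`-th elements of the sequences in `O` (positions counted from `0`). -/
def nthRows (O : Finset (List (Row α))) (i : ℕ) : Table α :=
  O.biUnion fun s => (s[i]?).toFinset

/-- Purging below a node `t` whose purged table is `ν`: in pre-order, each child keeps exactly the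
rows that occur in the origins of the rows kept at its parent. -/
def purgeFrom (prog : Program α) : TTree α (Table α) → Table α → TTree α (Table α)
  | .leaf b _, ν => .leaf b ν
  | .unary b τ c, ν =>
    .unary b ν (purgeFrom prog c (nthRows (origs prog (.unary b τ c) ν) 0))
  | .binary b τ l r, ν =>
    .binary b ν (purgeFrom prog l (nthRows (origs prog (.binary b τ l r) ν) 0))
      (purgeFrom prog r (nthRows (origs prog (.binary b τ l r) ν) 1))

/-- The purged tabled tree decomposition `(T, χ, ν)`: `ν(t)` consists of the rows obtained by
recursively following the origins of the rows of the root table. -/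
def purge (prog : Program α) (T : TTree α (Table α)) : TTree α (Table α) :=
  purgeFrom prog T T.tab

/-! ### The table algorithm PROJ -/

/-- The equivalence classes of `ρ` under equality of the interpretation parts restricted to `P`. -/
def buckets (P : Finset α) (ρ : Table α) : Finset (Table α) :=
  ρ.image fun u => ρ.filter fun v => v.interp ∩ P = u.interp ∩ P

/-- The non-empty subsets of the equivalence classes. -/
def subBuckets (P : Finset α) (ρ : Table α) : Finset (Table α) :=
  (buckets P ρ).biUnion fun B => B.powerset.erase ∅

/-- Tables of pairs `⟨ρ, c⟩`. -/
abbrev ProjTable (α : Type*) := Finset (Table α × ℕ)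

/-- The stored `ipmc` of `ρ` in the table `π`. -/
def sipmc (π : ProjTable α) (ρ : Table α) : ℕ :=
  ∑ x ∈ π.filter (fun x => x.1 = ρ), x.2

/-- The stored `ipmc` of a set of sequences of rows, for a sequence of tables. -/
def sipmcSeq (πs : List (ProjTable α)) (O : Finset (List (Row α))) : ℕ :=
  ∏ i ∈ Finset.range πs.length, sipmc (πs.getD i ∅) (nthRows O i)

/-- The projected count `pmc(t, ρ, ⟨π(t₁), …⟩)`, by inclusion-exclusion over the origins. -/
def pmc (prog : Program α) (t : TTree α (Table α)) (πs : List (ProjTable α)) (ρ : Table α) : ℤ :=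
  ∑ O ∈ (origs prog t ρ).powerset.erase ∅, (-1) ^ (O.card - 1) * (sipmcSeq πs O : ℤ)

/-- The intersection count `ipmc(t, ρ, ⟨π(t₁), …⟩)`: it is `1` at a leaf, and otherwise the absolute
value of `pmc(t, ρ) + ∑_{∅ ⊊ φ ⊊ ρ} (-1) ^ |φ| ipmc(t, φ)`. -/
def ipmc (prog : Program α) (t : TTree α (Table α)) (πs : List (ProjTable α)) (ρ : Table α) : ℕ :=
  if t.children.isEmpty then 1
  else (pmc prog t πs ρ +
    ∑ φ ∈ (ρ.ssubsets.erase ∅).attach, (-1) ^ φ.1.card * (ipmc prog t πs φ.1 : ℤ)).natAbs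
  termination_by ρ.card
  decreasing_by
    exact Finset.card_lt_card (Finset.mem_ssubsets.mp (Finset.mem_of_mem_erase φ.2))

/-- The table algorithm PROJ at the root of `t`, whose stored table is the purged table. -/
def proj (prog : Program α) (P : Finset α) (t : TTree α (Table α))
    (πs : List (ProjTable α)) : ProjTable α :=
  (subBuckets P t.tab).image fun ρ => (ρ, ipmc prog t πs ρ)

/-- `DP_PROJ`: computes `(T, χ, π)` from the purged `(T, χ, ν)`. -/
def dpPROJ (prog : Program α) (P : Finset α) : TTree α (Table α) → TTree α (ProjTable α) :=
  TTree.dp (proj prog P)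

/-- The algorithm `MDP_PHC` on the instance `(prog, P)`, run with the tree decomposition `T`. The
result is the count stored at the root for the table that consists of the row `⟨∅, ∅, ⟨⟩⟩` (and `0`
if none is stored). -/
def mdpPHC {ι : Type*} (prog : Program α) (P : Finset α) (T : TTree α ι) : ℕ :=
  sipmc (dpPROJ prog P (purge prog (dpPHC prog T))).tab {Row.empty α}

end PASP

/-! For a head-cycle-free program, an answer set is a model `I` whose atoms can be ordered so that
each atom `c` has a proving rule: the body holds in `I`, `c` is the only head atom in `I`, and the
positive body precedes `c` (`isAnswerSet_iff_exists_isProvenModel`). This characterization is local.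
The atoms of a rule are pairwise adjacent, so each rule fits into a bag, and whether it is satisfied
or proves an atom depends only on the restriction of `I` and of the order to that bag.

A row records such a restriction together with the atoms already proven. `sols prog T u` collects
the interpretations assembled by following origins from the row `u` down to the leaves. Soundness
glues the orders found below: two orders that agree on their common atoms have a common extension
(`exists_merge`), and connectedness keeps the common atoms inside the bag. Completeness restricts
one global order to all bags (`IsProvenModel.exists_mem_sols`). At the root, whose bag is empty, the
solutions of the empty row are the answer sets (`mem_sols_root_iff`).

For counting, let `projs` be the sets `I ∩ P` with `I` a solution of a row. The invariant
`CountsCommon` says that the number stored for `ρ` is the size of the intersection of `projs` over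
`ρ`. One inclusion-exclusion over origins gives the size of the union (`pmc_eq_card`); a second one,
solved for its top term, gives the intersection (`ipmc_eq_card`). Products of child counts are
correct because a projection determines its parts in the children. Several rows or orders yielding
the same `I ∩ P` do no harm, since unions of sets are counted. For the single row at the root, the
intersection is the whole set of projected answer sets. -/

namespace PASP

/-! ### Combinatorics of tree decompositions -/

section Trees

/-! ### Nice trees -/

namespace TTree

variable {α β : Type*}

/-- The bags of the nodes of the tree. -/
def bags : TTree α β → List (Finset α)
  | leaf b _ => [b]
  | unary b _ c => b :: c.bags
  | binary b _ l r => b :: (l.bags ++ r.bags)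

theorem bag_mem_bags (T : TTree α β) : T.bag ∈ T.bags := by
  cases T <;> simp [bag, bags]

theorem subtree?_cons {T c : TTree α β} {i : ℕ} (h : T.children[i]? = some c) (p : List ℕ) :
    T.subtree? (i :: p) = c.subtree? p := by
  simp [subtree?, h]

theorem hasNiceType_unary {b : Finset α} {x : β} {c : TTree α β}
    (hb : IsInt b c.bag ∨ IsRem b c.bag)
    (hc : ∀ p t, c.subtree? p = some t → t.HasNiceType) :
    ∀ p t, (unary b x c).subtree? p = some t → t.HasNiceType := by
  intro p t hp
  rcases p with _ | ⟨_ | i, p⟩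
  · obtain rfl := Option.some.inj hp
    exact hb
  · exact hc p t hp
  · simp [subtree?, children] at hp

@[simp] theorem bag_leaf (b : Finset α) (x : β) : (leaf b x).bag = b := rfl

@[simp] theorem bag_unary (b : Finset α) (x : β) (c : TTree α β) : (unary b x c).bag = b := rfl

@[simp] theorem bag_binary (b : Finset α) (x : β) (l r : TTree α β) :
    (binary b x l r).bag = b := rfl

theorem mem_bags_iff {T : TTree α β} {B : Finset α} :
    B ∈ T.bags ↔ ∃ p t, T.subtree? p = some t ∧ t.bag = B := by
  induction T with
  | leaf b x =>
    constructor
    · intro h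
      exact ⟨[], _, rfl, (List.mem_singleton.1 h).symm⟩
    · rintro ⟨p, t, h, rfl⟩
      cases p <;> simp_all [subtree?, children]
      subst h
      exact bag_mem_bags _
  | unary b x c ih =>
    simp only [bags, List.mem_cons, ih]
    constructor
    · rintro (rfl | ⟨p, t, h, rfl⟩)
      · exact ⟨[], _, rfl, rfl⟩
      · exact ⟨0 :: p, t, by simpa [subtree?, children] using h, rfl⟩
    · rintro ⟨p, t, h, rfl⟩
      rcases p with _ | ⟨_ | i, p⟩
      · simp only [subtree?, Option.some.injEq] at h
        subst h
        exact Or.inl rfl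
      · exact Or.inr ⟨p, t, by simpa [subtree?, children] using h, rfl⟩
      · simp [subtree?, children] at h
  | binary b x l r ihl ihr =>
    simp only [bags, List.mem_cons, List.mem_append, ihl, ihr]
    constructor
    · rintro (rfl | ⟨p, t, h, rfl⟩ | ⟨p, t, h, rfl⟩)
      · exact ⟨[], _, rfl, rfl⟩
      · exact ⟨0 :: p, t, by simpa [subtree?, children] using h, rfl⟩
      · exact ⟨1 :: p, t, by simpa [subtree?, children] using h, rfl⟩
    · rintro ⟨p, t, h, rfl⟩
      rcases p with _ | ⟨_ | _ | i, p⟩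
      · simp only [subtree?, Option.some.injEq] at h
        subst h
        exact Or.inl rfl
      · exact Or.inr (Or.inl ⟨p, t, by simpa [subtree?, children] using h, rfl⟩)
      · exact Or.inr (Or.inr ⟨p, t, by simpa [subtree?, children] using h, rfl⟩)
      · simp [subtree?, children] at h

/-- The connectedness condition on the bags. -/
def Paths (T : TTree α β) : Prop :=
  ∀ p q s tp tq ts, T.subtree? p = some tp → T.subtree? q = some tq →
    T.subtree? s = some ts → OnPath p s q → ∀ v, v ∈ tp.bag → v ∈ tq.bag → v ∈ ts.bag

theorem OnPath.cons {r s t : List ℕ} (i : ℕ) (h : OnPath r s t) :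
    OnPath (i :: r) (i :: s) (i :: t) := by
  refine ⟨by simpa [List.cons_prefix_cons] using h.1, ?_⟩
  intro c h1 h2
  cases c with
  | nil => exact List.nil_prefix
  | cons j c =>
    rw [List.cons_prefix_cons] at h1 h2 ⊢
    exact ⟨h1.1, h.2 c h1.2 h2.2⟩

theorem Paths.child {T c : TTree α β} {i : ℕ} (hT : T.Paths) (h : T.children[i]? = some c) :
    c.Paths := by
  intro p q s tp tq ts hp hq hs hon
  exact hT (i :: p) (i :: q) (i :: s) tp tq ts (by rw [subtree?_cons h, hp])
    (by rw [subtree?_cons h, hq]) (by rw [subtree?_cons h, hs]) (hon.cons i)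

variable [DecidableEq α]

/-- The atoms that occur in some bag of the tree. -/
def cover : TTree α β → Finset α
  | leaf b _ => b
  | unary b _ c => b ∪ c.cover
  | binary b _ l r => b ∪ (l.cover ∪ r.cover)

@[simp] theorem cover_leaf (b : Finset α) (x : β) : (leaf b x).cover = b := rfl

@[simp] theorem cover_unary (b : Finset α) (x : β) (c : TTree α β) :
    (unary b x c).cover = b ∪ c.cover := rfl

@[simp] theorem cover_binary (b : Finset α) (x : β) (l r : TTree α β) :
    (binary b x l r).cover = b ∪ (l.cover ∪ r.cover) := rfl

theorem mem_cover {T : TTree α β} {v : α} : v ∈ T.cover ↔ ∃ B ∈ T.bags, v ∈ B := by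
  induction T with
  | leaf b x => simp [bags, cover]
  | unary b x c ih => simp [bags, cover, ih]
  | binary b x l r ihl ihr =>
    simp only [bags, cover, Finset.mem_union, ihl, ihr, List.mem_cons, List.mem_append]
    grind

theorem bag_subset_cover (T : TTree α β) : T.bag ⊆ T.cover := fun _ hv =>
  mem_cover.2 ⟨_, T.bag_mem_bags, hv⟩

theorem mem_cover_iff_subtree {T : TTree α β} {v : α} :
    v ∈ T.cover ↔ ∃ p t, T.subtree? p = some t ∧ v ∈ t.bag := by
  rw [mem_cover]
  constructor
  · rintro ⟨B, hB, hv⟩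
    obtain ⟨p, t, h, rfl⟩ := mem_bags_iff.1 hB
    exact ⟨p, t, h, hv⟩
  · rintro ⟨p, t, h, hv⟩
    exact ⟨_, mem_bags_iff.2 ⟨p, t, h, rfl⟩, hv⟩

/-- A tree all of whose nodes are leaf, introduce, removal or join nodes, and in which the nodes
whose bags contain a given atom are connected. -/
inductive NiceTree : TTree α β → Prop
  | leaf (x : β) : NiceTree (leaf ∅ x)
  | introduce (a : α) (x : β) (c : TTree α β) (ha : a ∉ c.cover) (hc : NiceTree c) :
      NiceTree (unary (insert a c.bag) x c)
  | removal (a : α) (x : β) (c : TTree α β) (ha : a ∈ c.bag) (hc : NiceTree c) :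
      NiceTree (unary (c.bag.erase a) x c)
  | join (b : Finset α) (x : β) (l r : TTree α β) (hbl : l.bag = b) (hbr : r.bag = b)
      (hne : b ≠ ∅) (hlr : l.cover ∩ r.cover ⊆ b) (hl : NiceTree l) (hr : NiceTree r) :
      NiceTree (binary b x l r)

/-- The child lies on the path from the root to every node of the child's subtree. -/
theorem Paths.mem_child_bag {T c : TTree α β} {i : ℕ} (hT : T.Paths)
    (h : T.children[i]? = some c) {v : α} (hv : v ∈ T.bag) (hc : v ∈ c.cover) : v ∈ c.bag := by
  obtain ⟨p, t, hp, hvt⟩ := mem_cover_iff_subtree.1 hc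
  refine hT [] (i :: p) [i] T t c rfl (by rw [subtree?_cons h, hp])
    (by rw [subtree?_cons h]; cases c <;> rfl) ⟨Or.inr (by simp), ?_⟩ v hv hvt
  intro d h1 _
  rw [List.prefix_nil.1 h1]
  exact List.nil_prefix

/-- The root lies on every path that joins the subtrees of two different children. -/
theorem Paths.mem_bag {T c d : TTree α β} {i j : ℕ} (hT : T.Paths) (hij : i ≠ j)
    (hi : T.children[i]? = some c) (hj : T.children[j]? = some d) {v : α} (hc : v ∈ c.cover)
    (hd : v ∈ d.cover) : v ∈ T.bag := by
  obtain ⟨p, t, hp, hvt⟩ := mem_cover_iff_subtree.1 hc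
  obtain ⟨q, t', hq, hvt'⟩ := mem_cover_iff_subtree.1 hd
  refine hT (i :: p) (j :: q) [] t t' T (by rw [subtree?_cons hi, hp])
    (by rw [subtree?_cons hj, hq]) (by cases T <;> rfl) ⟨Or.inl List.nil_prefix, ?_⟩ v hvt hvt'
  intro e h1 h2
  cases e with
  | nil => exact List.nil_prefix
  | cons k e =>
    rw [List.cons_prefix_cons] at h1 h2
    exact absurd (h1.1.symm.trans h2.1) hij

/-- This replaces the global path condition by what the inductions need at each node: an introduced
atom is new to the whole subtree, and atoms on both sides of a join belong to its bag. -/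
theorem niceTree_of_paths {T : TTree α β} (hT : T.Paths)
    (hn : ∀ p t, T.subtree? p = some t → t.HasNiceType) : NiceTree T := by
  have hchild : ∀ {T c : TTree α β} {i : ℕ}, T.children[i]? = some c →
      (∀ p t, T.subtree? p = some t → t.HasNiceType) →
      ∀ p t, c.subtree? p = some t → t.HasNiceType := by
    intro T c i h hn p t hp
    exact hn (i :: p) t (by rw [subtree?_cons h, hp])
  induction T with
  | leaf b x =>
    have : b = ∅ := hn [] _ rfl
    subst this
    exact .leaf x
  | unary b x c ih =>
    have h0 : (unary b x c).children[0]? = some c := rfl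
    have hc := ih (hT.child h0) (hchild h0 hn)
    rcases (hn [] _ rfl : IsInt b c.bag ∨ IsRem b c.bag) with ⟨hsub, hcard⟩ | ⟨hsub, hcard⟩
    · obtain ⟨a, ha, hab⟩ := Finset.exists_eq_insert_iff.2 ⟨hsub, hcard.symm⟩
      subst hab
      refine .introduce a x c (fun h => ha ?_) hc
      exact hT.mem_child_bag h0 (Finset.mem_insert_self a _) h
    · obtain ⟨a, ha, hab⟩ := Finset.exists_eq_insert_iff.2 ⟨hsub, hcard.symm⟩
      have hb : b = c.bag.erase a := by rw [← hab, Finset.erase_insert ha]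
      subst hb
      exact .removal a x c (hab ▸ Finset.mem_insert_self a _) hc
  | binary b x l r ihl ihr =>
    have h0 : (binary b x l r).children[0]? = some l := rfl
    have h1 : (binary b x l r).children[1]? = some r := rfl
    obtain ⟨hl, hr, hb⟩ := (hn [] _ rfl : IsJoin b l.bag r.bag)
    refine .join b x l r hl.symm hr.symm hb ?_ (ihl (hT.child h0) (hchild h0 hn))
      (ihr (hT.child h1) (hchild h1 hn))
    intro v hv
    rw [Finset.mem_inter] at hv
    exact hT.mem_bag zero_ne_one h0 h1 hv.1 hv.2

/-- Sets of pairwise adjacent atoms are contained in a bag. -/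
theorem NiceTree.exists_bag_of_pairwise {T : TTree α β} (hT : NiceTree T) {S : Finset α}
    (hS : ∀ u ∈ S, ∀ v ∈ S, ∃ B ∈ T.bags, u ∈ B ∧ v ∈ B) : ∃ B ∈ T.bags, S ⊆ B := by
  induction hT with
  | leaf x =>
    refine ⟨∅, by simp [bags], fun u hu => ?_⟩
    obtain ⟨B, hB, h, -⟩ := hS u hu u hu
    simp only [bags, List.mem_singleton] at hB
    exact hB ▸ h
  | introduce a x c ha hc ih =>
    -- The atom `a` occurs in the root bag only, so that bag contains every atom sharing a bag with
    -- `a`.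
    by_cases haS : a ∈ S
    · refine ⟨_, bag_mem_bags _, fun v hv => ?_⟩
      obtain ⟨B, hB, h1, h2⟩ := hS a haS v hv
      simp only [bags, List.mem_cons] at hB
      rcases hB with rfl | hB
      · exact h2
      · exact absurd (mem_cover.2 ⟨B, hB, h1⟩) ha
    · obtain ⟨B, hB, hSB⟩ := ih (by
        intro u hu v hv
        obtain ⟨B, hB, h1, h2⟩ := hS u hu v hv
        simp only [bags, List.mem_cons] at hB
        rcases hB with rfl | hB
        · refine ⟨c.bag, c.bag_mem_bags, Finset.mem_of_mem_insert_of_ne h1 ?_,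
            Finset.mem_of_mem_insert_of_ne h2 ?_⟩
          · rintro rfl; exact haS hu
          · rintro rfl; exact haS hv
        · exact ⟨B, hB, h1, h2⟩)
      exact ⟨B, by simp [bags, hB], hSB⟩
  | removal a x c ha hc ih =>
    obtain ⟨B, hB, hSB⟩ := ih (by
      intro u hu v hv
      obtain ⟨B, hB, h1, h2⟩ := hS u hu v hv
      simp only [bags, List.mem_cons] at hB
      rcases hB with rfl | hB
      · exact ⟨c.bag, c.bag_mem_bags, Finset.mem_of_mem_erase h1, Finset.mem_of_mem_erase h2⟩
      · exact ⟨B, hB, h1, h2⟩)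
    exact ⟨B, by simp [bags, hB], hSB⟩
  | join b x l r hbl hbr hne hlr hl hr ihl ihr =>
    -- An atom `y` of `S` outside `b` lives on one side only. All of `S` shares bags with `y` and so
    -- lies on that side; a pair that meets in a bag of the other side then lies in `b`, the root
    -- bag of this side.
    by_cases hSb : S ⊆ b
    · exact ⟨b, by simp [bags], hSb⟩
    obtain ⟨y, hyS, hyb⟩ := Finset.not_subset.1 hSb
    have hmem : ∀ {B}, B ∈ (binary b x l r).bags → B = b ∨ B ∈ l.bags ∨ B ∈ r.bags := by
      intro B hB
      simpa [bags] using hB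
    have hylr : y ∈ l.cover → y ∉ r.cover := fun h1 h2 =>
      hyb (hlr (Finset.mem_inter.2 ⟨h1, h2⟩))
    by_cases hyl : y ∈ l.cover
    · obtain ⟨B, hB, hSB⟩ := ihl (by
        have hbel : ∀ v ∈ S, v ∈ l.cover := by
          intro v hv
          obtain ⟨B, hB, h1, h2⟩ := hS y hyS v hv
          rcases hmem hB with rfl | hB | hB
          · exact absurd h1 hyb
          · exact mem_cover.2 ⟨B, hB, h2⟩
          · exact absurd (mem_cover.2 ⟨B, hB, h1⟩) (hylr hyl)
        intro u hu v hv
        obtain ⟨B, hB, h1, h2⟩ := hS u hu v hv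
        rcases hmem hB with rfl | hB | hB
        · exact ⟨_, l.bag_mem_bags, hbl ▸ h1, hbl ▸ h2⟩
        · exact ⟨B, hB, h1, h2⟩
        · exact ⟨_, l.bag_mem_bags,
            hbl ▸ hlr (Finset.mem_inter.2 ⟨hbel u hu, mem_cover.2 ⟨B, hB, h1⟩⟩),
            hbl ▸ hlr (Finset.mem_inter.2 ⟨hbel v hv, mem_cover.2 ⟨B, hB, h2⟩⟩)⟩)
      exact ⟨B, by simp [bags, hB], hSB⟩
    · obtain ⟨B, hB, hSB⟩ := ihr (by
        have hbel : ∀ v ∈ S, v ∈ r.cover := by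
          intro v hv
          obtain ⟨B, hB, h1, h2⟩ := hS y hyS v hv
          rcases hmem hB with rfl | hB | hB
          · exact absurd h1 hyb
          · exact absurd (mem_cover.2 ⟨B, hB, h1⟩) hyl
          · exact mem_cover.2 ⟨B, hB, h2⟩
        intro u hu v hv
        obtain ⟨B, hB, h1, h2⟩ := hS u hu v hv
        rcases hmem hB with rfl | hB | hB
        · exact ⟨_, r.bag_mem_bags, hbr ▸ h1, hbr ▸ h2⟩
        · exact ⟨_, r.bag_mem_bags,
            hbr ▸ hlr (Finset.mem_inter.2 ⟨mem_cover.2 ⟨B, hB, h1⟩, hbel u hu⟩),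
            hbr ▸ hlr (Finset.mem_inter.2 ⟨mem_cover.2 ⟨B, hB, h2⟩, hbel v hv⟩)⟩
        · exact ⟨B, hB, h1, h2⟩)
      exact ⟨B, by simp [bags, hB], hSB⟩

/-! ### Existence of nice tree decompositions -/

/-- Every path from the new root into the tree passes through `c`, so only the overlap of `b` with
the bags below has to be controlled. -/
theorem Paths.unary {b : Finset α} {x : β} {c : TTree α β} (hc : c.Paths)
    (hb : b ∩ c.cover ⊆ c.bag) : (unary b x c).Paths := by
  have h0 : (TTree.unary b x c).children[0]? = some c := rfl
  have hsub : ∀ {p t}, (TTree.unary b x c).subtree? p = some t →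
      (p = [] ∧ t = .unary b x c) ∨ ∃ p', p = 0 :: p' ∧ c.subtree? p' = some t := by
    intro p t hp
    rcases p with _ | ⟨_ | i, p⟩
    · exact Or.inl ⟨rfl, (Option.some.inj hp).symm⟩
    · exact Or.inr ⟨p, rfl, by rwa [subtree?_cons h0] at hp⟩
    · simp [subtree?, children] at hp
  have hroot : ∀ {q s : List ℕ} {tq ts}, c.subtree? q = some tq → c.subtree? s = some ts →
      s <+: q → ∀ v, v ∈ b → v ∈ tq.bag → v ∈ ts.bag := by
    intro q s tq ts hq hs hsq v hv hvq
    have hvc : v ∈ c.bag :=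
      hb (Finset.mem_inter.2 ⟨hv, mem_cover_iff_subtree.2 ⟨q, tq, hq, hvq⟩⟩)
    refine hc [] q s c tq ts (by cases c <;> rfl) hq hs ⟨Or.inr hsq, ?_⟩ v hvc hvq
    intro d h1 _
    rw [List.prefix_nil.1 h1]
    exact List.nil_prefix
  intro p q s tp tq ts hp hq hs hon v hvp hvq
  rcases hsub hs with ⟨rfl, rfl⟩ | ⟨s, rfl, hs⟩
  · rcases hsub hp with ⟨rfl, rfl⟩ | ⟨p, rfl, hp⟩
    · exact hvp
    · rcases hsub hq with ⟨rfl, rfl⟩ | ⟨q, rfl, hq⟩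
      · exact hvq
      · have := hon.2 [0] (by simp) (by simp)
        simp at this
  · rcases hsub hp with ⟨rfl, rfl⟩ | ⟨p, rfl, hp⟩
    · rcases hsub hq with ⟨rfl, rfl⟩ | ⟨q, rfl, hq⟩
      · simp [OnPath] at hon
      · refine hroot hq hs ?_ v hvp hvq
        simpa [List.cons_prefix_cons] using hon.1
    · rcases hsub hq with ⟨rfl, rfl⟩ | ⟨q, rfl, hq⟩
      · refine hroot hp hs ?_ v hvq hvp
        simpa [List.cons_prefix_cons] using hon.1
      · refine hc p q s tp tq ts hp hq hs
          ⟨by simpa [List.cons_prefix_cons] using hon.1, fun d h1 h2 => ?_⟩ v hvp hvq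
        have := hon.2 (0 :: d) (by simpa [List.cons_prefix_cons] using h1)
          (by simpa [List.cons_prefix_cons] using h2)
        simpa [List.cons_prefix_cons] using this

theorem exists_introduce_chain (V : Finset α) : ∃ T : TTree α Unit, T.Paths ∧
    (∀ p t, T.subtree? p = some t → t.HasNiceType) ∧ T.bag = V ∧ T.cover = V := by
  induction V using Finset.induction_on with
  | empty =>
    refine ⟨leaf ∅ (), ?_, ?_, rfl, rfl⟩
    · intro p q s tp tq ts hp _ _ _ v hv
      rcases p with _ | ⟨i, p⟩
      · obtain rfl := Option.some.inj hp
        exact absurd hv (Finset.notMem_empty v)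
      · simp [subtree?, children] at hp
    · intro p t hp
      rcases p with _ | ⟨i, p⟩
      · obtain rfl := Option.some.inj hp
        rfl
      · simp [subtree?, children] at hp
  | insert a V ha ih =>
    obtain ⟨T, h1, h2, h3, h4⟩ := ih
    refine ⟨unary (insert a V) () T, h1.unary ?_, hasNiceType_unary (Or.inl ?_) h2, rfl, ?_⟩
    · rw [h3, h4]
      exact Finset.inter_subset_right
    · rw [h3]
      exact ⟨Finset.subset_insert a V, Finset.card_insert_of_notMem ha⟩
    · rw [cover, h4]
      exact Finset.union_eq_left.2 (Finset.subset_insert a V)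

theorem exists_removal_chain (S : Finset α) (T : TTree α Unit) (h1 : T.Paths)
    (h2 : ∀ p t, T.subtree? p = some t → t.HasNiceType) (h3 : T.bag = S) :
    ∃ T' : TTree α Unit, T'.Paths ∧ (∀ p t, T'.subtree? p = some t → t.HasNiceType) ∧
      T'.bag = ∅ ∧ T'.cover = T.cover ∧ T.bags ⊆ T'.bags := by
  induction S using Finset.induction_on generalizing T with
  | empty => exact ⟨T, h1, h2, h3, rfl, fun _ h => h⟩
  | insert a S ha ih =>
    have hS : S ⊆ T.bag := h3 ▸ Finset.subset_insert a S
    obtain ⟨T', g1, g2, g3, g4, g5⟩ := ih (unary S () T)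
      (h1.unary (Finset.inter_subset_left.trans hS))
      (hasNiceType_unary (Or.inr ⟨hS, h3 ▸ Finset.card_insert_of_notMem ha⟩) h2) rfl
    refine ⟨T', g1, g2, g3, g4.trans ?_, fun B hB => g5 (List.mem_cons_of_mem _ hB)⟩
    exact Finset.union_eq_right.2 (hS.trans T.bag_subset_cover)

end TTree

variable {α : Type*} [DecidableEq α]

/-- Width is irrelevant here: a chain introduces all atoms and then removes them, and its largest
bag covers all vertices and edges. -/
theorem exists_isNiceTD (prog : Program α) : ∃ T : TTree α Unit, IsNiceTD prog T := by
  obtain ⟨T, h1, h2, h3, h4⟩ := TTree.exists_introduce_chain (atoms prog)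
  obtain ⟨T', g1, g2, g3, g4, g5⟩ := TTree.exists_removal_chain _ T h1 h2 h3
  refine ⟨T', ⟨fun v => ?_, fun u v huv => ?_, g1⟩, g2, g3⟩
  · rw [← TTree.mem_cover_iff_subtree, g4, h4]
  · obtain ⟨p, t, hp, ht⟩ := TTree.mem_bags_iff.1 (g5 T.bag_mem_bags)
    obtain ⟨-, r, hr, hu, hv⟩ := huv
    refine ⟨p, t, hp, ?_⟩
    rw [ht, h3]
    exact ⟨Finset.mem_biUnion.2 ⟨r, hr, hu⟩, Finset.mem_biUnion.2 ⟨r, hr, hv⟩⟩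

theorem IsNiceTD.niceTree {β : Type*} {prog : Program α} {T : TTree α β} (h : IsNiceTD prog T) :
    T.NiceTree :=
  TTree.niceTree_of_paths h.1.paths h.2.1

theorem IsNiceTD.cover_eq {β : Type*} {prog : Program α} {T : TTree α β} (h : IsNiceTD prog T) :
    T.cover = atoms prog := by
  ext v
  rw [h.1.vertices, TTree.mem_cover_iff_subtree]

theorem IsNiceTD.exists_bag_of_mem {β : Type*} {prog : Program α} {T : TTree α β}
    (h : IsNiceTD prog T) {r : Rule α} (hr : r ∈ prog) : ∃ B ∈ T.bags, r.atoms ⊆ B := by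
  refine h.niceTree.exists_bag_of_pairwise fun u hu v hv => ?_
  -- The primal graph has no loops, so the case of one atom needs the covering of vertices rather
  -- than of edges.
  by_cases huv : u = v
  · subst huv
    have : u ∈ T.cover := h.cover_eq ▸ Finset.mem_biUnion.2 ⟨r, hr, hu⟩
    obtain ⟨B, hB, h⟩ := TTree.mem_cover.1 this
    exact ⟨B, hB, h, h⟩
  · obtain ⟨p, t, hp, h1, h2⟩ := h.1.edges u v ⟨huv, r, hr, hu, hv⟩
    exact ⟨_, TTree.mem_bags_iff.2 ⟨p, t, hp, rfl⟩, h1, h2⟩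

end Trees

/-! ### Orders that witness answer sets -/

section AnswerSets

variable {α : Type*} [DecidableEq α]

/-! ### Answer sets of head-cycle-free programs -/

/-- The rule `r` proves the atom `c` from the interpretation `I` along the sequence `σ`. -/
def Rule.Proves (r : Rule α) (I : Finset α) (σ : List α) (c : α) : Prop :=
  c ∈ r.head ∧ r.posBody ⊆ I ∧ I ∩ r.negBody = ∅ ∧ I ∩ (r.head \ {c}) = ∅ ∧
    ∀ b ∈ r.posBody, [b, c].Sublist σ

theorem mem_gatherProof {I : Finset α} {σ : List α} {prog : Program α} {c : α} :
    c ∈ gatherProof I σ prog ↔ ∃ r ∈ prog, r.Proves I σ c := by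
  simp [gatherProof, Rule.Proves]

/-- The interpretation `I` is a model all of whose atoms are proven along the sequence `σ`. -/
structure IsProvenModel (prog : Program α) (I : Finset α) (σ : List α) : Prop where
  isModel : IsModel prog I
  nodup : σ.Nodup
  mem_iff : ∀ c, c ∈ σ ↔ c ∈ I
  proves : ∀ c ∈ I, ∃ r ∈ prog, r.Proves I σ c

theorem Rule.sat_iff {I : Finset α} {r : Rule α} :
    r.Sat I ↔ (r.posBody ⊆ I → Disjoint r.negBody I → ∃ c ∈ r.head, c ∈ I) := by
  unfold Rule.Sat
  rw [Finset.sdiff_nonempty]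
  constructor
  · rintro (⟨c, hc⟩ | h) h1 h2
    · simp only [Finset.mem_inter, Finset.mem_union] at hc
      rcases hc.1 with h | h
      · exact ⟨c, h, hc.2⟩
      · exact absurd hc.2 (Finset.disjoint_left.1 h2 h)
    · exact absurd h1 h
  · intro h
    by_cases h1 : r.posBody ⊆ I
    · left
      by_cases h2 : Disjoint r.negBody I
      · obtain ⟨c, hc, hI⟩ := h h1 h2
        exact ⟨c, by simp [hc, hI]⟩
      · obtain ⟨c, hc, hI⟩ := Finset.not_disjoint_iff.1 h2
        exact ⟨c, by simp [hc, hI]⟩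
    · exact Or.inr h1

theorem isModel_reduct_iff {prog : Program α} {I J : Finset α} :
    IsModel (reduct prog I) J ↔
      ∀ r ∈ prog, Disjoint r.negBody I → r.posBody ⊆ J → ∃ c ∈ r.head, c ∈ J := by
  simp only [IsModel, reduct, Rule.sat_iff, Finset.forall_mem_image, Finset.mem_filter, and_imp]
  simp [Rule.positivePart]

/-- A model `J ⊆ I` of the reduct absorbs the atoms of `I` in the order of `σ`: the rule proving `c`
has its positive body in `J` by induction, and `c` is its only head atom available in `I`. -/
theorem IsProvenModel.isAnswerSet {prog : Program α} {I : Finset α} {σ : List α}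
    (h : IsProvenModel prog I σ) : IsAnswerSet prog I := by
  refine ⟨isModel_reduct_iff.2 fun r hr h1 h2 => Rule.sat_iff.1 (h.isModel r hr) h2 h1, ?_⟩
  intro J hJ hJI
  rw [isModel_reduct_iff] at hJ
  have key : ∀ n c, σ.idxOf c = n → c ∈ I → c ∈ J := by
    intro n
    induction n using Nat.strong_induction_on with
    | _ n ih =>
      intro c hn hc
      obtain ⟨r, hr, hcH, hp, hneg, hh, hord⟩ := h.proves c hc
      obtain ⟨d, hd, hdJ⟩ := hJ r hr
        (by rw [Finset.disjoint_iff_inter_eq_empty, Finset.inter_comm]; exact hneg) (by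
          intro b hb
          refine ih (σ.idxOf b) ?_ b rfl (hp hb)
          -- As `σ` has no duplicates, `b` occurring before `c` means that the index of `b` is
          -- smaller.
          obtain ⟨l, l', hl, h1, h2⟩ := List.cons_sublist_iff.1 (hord b hb)
          have hcl : c ∉ l := by
            intro hcl
            have := h.nodup
            rw [hl, List.nodup_append] at this
            exact this.2.2 c hcl c (List.singleton_sublist.1 h2) rfl
          rw [← hn, hl, List.idxOf_append_of_mem h1, List.idxOf_append_of_notMem hcl]
          have := List.idxOf_lt_length_iff.2 h1
          omega)
      by_cases hdc : d = c
      · exact hdc ▸ hdJ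
      · have : d ∈ I ∩ (r.head \ {c}) := by simp [hd, hdc, hJI hdJ]
        rw [hh] at this
        simp at this
  exact fun c hc => key _ c rfl hc

theorem Rule.Proves.mono {r : Rule α} {I : Finset α} {σ σ' : List α} {c : α}
    (h : r.Proves I σ c) (hσ : σ.Sublist σ') : r.Proves I σ' c :=
  ⟨h.1, h.2.1, h.2.2.1, h.2.2.2.1, fun b hb => (h.2.2.2.2 b hb).trans hσ⟩

/-- Take a proven sequence `σ` that cannot be extended. If atoms of `I` are missing, some strongly
connected set `U` of missing atoms has no missing ancestors outside itself. By minimality, `I \ U`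
violates a rule of the reduct. Its positive body then lies in `σ`, its head atoms in `I` all lie in
`U`, and head-cycle-freeness leaves only one of them, so the rule extends `σ`. -/
theorem IsAnswerSet.exists_isProvenModel {prog : Program α} (hcf : HeadCycleFree prog)
    {I : Finset α} (h : IsAnswerSet prog I) : ∃ σ, IsProvenModel prog I σ := by
  classical
  have hmod := isModel_reduct_iff.1 h.1
  let Q : List α → Prop := fun σ => σ.Nodup ∧ (∀ c ∈ σ, c ∈ I) ∧
    ∀ c ∈ σ, ∃ r ∈ prog, r.Proves I σ c
  obtain ⟨σ, ⟨hnd, hsub, hprov⟩, hmax⟩ :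
      ∃ σ, Q σ ∧ ∀ c ∈ I, c ∉ σ → ¬ Q (σ ++ [c]) := by
    by_contra! hcon
    -- Unlimited extension would give duplicate-free sequences in `I` longer than `I.card`.
    have : ∀ n, ∃ σ, Q σ ∧ σ.length = n := by
      intro n
      induction n with
      | zero => exact ⟨[], by simp [Q]⟩
      | succ n ih =>
        obtain ⟨σ, hσ, hn⟩ := ih
        obtain ⟨c, -, -, hc⟩ := hcon σ hσ
        exact ⟨_, hc, by simp [hn]⟩
    obtain ⟨σ, hσ, hn⟩ := this (I.card + 1)
    have h1 : σ.toFinset.card ≤ I.card :=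
      Finset.card_le_card fun c hc => hσ.2.1 c (List.mem_toFinset.1 hc)
    rw [List.toFinset_card_of_nodup hσ.1] at h1
    omega
  have hclosed : ∀ c ∈ I, ∀ r ∈ prog, c ∈ r.head → (∀ b ∈ r.posBody, b ∈ σ) →
      I ∩ r.negBody = ∅ → I ∩ (r.head \ {c}) = ∅ → c ∈ σ := by
    intro c hc r hr hcr hb h1 h2
    by_contra hcσ
    refine hmax c hc hcσ ⟨?_, ?_, ?_⟩
    · rw [List.nodup_append]
      refine ⟨hnd, List.nodup_singleton c, ?_⟩
      rintro a ha b hb rfl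
      exact hcσ (List.mem_singleton.1 hb ▸ ha)
    · simp only [List.mem_append, List.mem_singleton]
      rintro d (hd | rfl)
      · exact hsub d hd
      · exact hc
    · simp only [List.mem_append, List.mem_singleton]
      rintro d (hd | rfl)
      · obtain ⟨r', hr', hp⟩ := hprov d hd
        exact ⟨r', hr', hp.mono (List.sublist_append_left _ _)⟩
      · exact ⟨r, hr, hcr, fun b hb' => hsub b (hb b hb'), h1, h2, fun b hb' =>
          List.Sublist.append (List.singleton_sublist.2 (hb b hb')) (List.Sublist.refl [d])⟩
  have hall : ∀ c ∈ I, c ∈ σ := by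
    by_contra! hcon
    let R := Relation.ReflTransGen (DepEdge prog)
    let N := I.filter (· ∉ σ)
    have hN : N.Nonempty := by
      obtain ⟨c, hc, hcσ⟩ := hcon
      exact ⟨c, by simp [N, hc, hcσ]⟩
    obtain ⟨x, hx, hxmin⟩ := Finset.exists_min_image N (fun x => (N.filter (R · x)).card) hN
    let U := N.filter (R · x)
    have hUx : ∀ y ∈ U, R x y := by
      intro y hy
      obtain ⟨hyN, hyx⟩ := Finset.mem_filter.1 hy
      have hsubs : N.filter (R · y) ⊆ N.filter (R · x) := fun z hz => by
        rw [Finset.mem_filter] at hz ⊢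
        exact ⟨hz.1, hz.2.trans hyx⟩
      have := Finset.eq_of_subset_of_card_le hsubs (hxmin y hyN)
      have hx' : x ∈ N.filter (R · y) := by
        rw [this]
        exact Finset.mem_filter.2 ⟨hx, Relation.ReflTransGen.refl⟩
      exact (Finset.mem_filter.1 hx').2
    have hUI : U ⊆ I := fun y hy => (Finset.mem_filter.1 (Finset.mem_filter.1 hy).1).1
    have hle : I ≤ I \ U := by
      refine h.2 (isModel_reduct_iff.2 ?_) Finset.sdiff_subset
      intro r hr hneg hpos
      by_contra! hno
      obtain ⟨c, hcH, hcI⟩ := hmod r hr hneg (hpos.trans Finset.sdiff_subset)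
      have hU : ∀ d ∈ r.head, d ∈ I → d ∈ U := fun d hd hdI => by
        by_contra hdU
        exact hno d hd (Finset.mem_sdiff.2 ⟨hdI, hdU⟩)
      have hcU := hU c hcH hcI
      have hcσ : c ∉ σ := (Finset.mem_filter.1 (Finset.mem_filter.1 hcU).1).2
      refine hcσ (hclosed c hcI r hr hcH ?_ ?_ ?_)
      · intro b hb
        by_contra hbσ
        have hbI := Finset.mem_sdiff.1 (hpos hb)
        refine hbI.2 (Finset.mem_filter.2 ⟨Finset.mem_filter.2 ⟨hbI.1, hbσ⟩, ?_⟩)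
        exact Relation.ReflTransGen.head ⟨r, hr, hb, hcH⟩ (Finset.mem_filter.1 hcU).2
      · rw [Finset.inter_comm, ← Finset.disjoint_iff_inter_eq_empty]
        exact hneg
      · rw [Finset.eq_empty_iff_forall_notMem]
        intro d hd
        simp only [Finset.mem_inter, Finset.mem_sdiff, Finset.mem_singleton] at hd
        obtain ⟨hdI, hdH, hdc⟩ := hd
        have hdU := hU d hdH hdI
        have e : ∀ y ∈ U, ∀ z ∈ U, y ≠ z → Relation.TransGen (DepEdge prog) y z := by
          intro y hy z hz hyz
          have : R y z := (Finset.mem_filter.1 hy).2.trans (hUx z hz)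
          exact (Relation.reflTransGen_iff_eq_or_transGen.1 this).resolve_left (Ne.symm hyz)
        exact hcf ⟨r, hr, c, hcH, d, hdH, Ne.symm hdc, e c hcU d hdU (Ne.symm hdc),
          e d hdU c hcU hdc⟩
    have hxU : x ∈ U := Finset.mem_filter.2 ⟨hx, Relation.ReflTransGen.refl⟩
    exact (Finset.mem_sdiff.1 (hle (hUI hxU))).2 hxU
  exact ⟨σ, fun r hr => Rule.sat_iff.2 fun h1 h2 => hmod r hr h2 h1, hnd,
    fun c => ⟨hsub c, hall c⟩, fun c hc => hprov c (hall c hc)⟩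

theorem isAnswerSet_iff_exists_isProvenModel {prog : Program α} (hcf : HeadCycleFree prog)
    {I : Finset α} : IsAnswerSet prog I ↔ ∃ σ, IsProvenModel prog I σ :=
  ⟨fun h => h.exists_isProvenModel hcf, fun ⟨_, h⟩ => h.isAnswerSet⟩

end AnswerSets

/-! ### Gluing sequences, and the solutions of a row -/

section Rows

/-! ### Merging sequences -/

section Lists

variable {α : Type*}

theorem _root_.List.Sublist.eq_filter_mem {l l' : List α} (h : l'.Sublist l) (hl : l.Nodup)
    {p : α → Prop} [DecidablePred p] (hp : ∀ x ∈ l, x ∈ l' ↔ p x) :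
    l' = l.filter (fun x => p x) := by
  have h1 : l'.filter (fun x => p x) = l' :=
    List.filter_eq_self.2 fun x hx => by simpa using (hp x (h.subset hx)).1 hx
  have h2 : l'.Sublist (l.filter fun x => p x) := h1 ▸ h.filter _
  refine h2.eq_of_length_le ?_
  refine (List.Nodup.subperm (hl.filter _) fun x hx => ?_).length_le
  rw [List.mem_filter] at hx
  exact (hp x hx.1).2 (by simpa using hx.2)

theorem insertIdx_length_append (l l' : List α) (a : α) :
    (l ++ l').insertIdx l.length a = l ++ a :: l' := by
  induction l with
  | nil => simp
  | cons x l ih => simp [ih]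

variable [DecidableEq α]

/-- A first element missing from the other sequence may be emitted at once. If both first elements
occur in the other sequence, each is the first common element, so they coincide and are emitted
together. -/
theorem exists_merge (l₁ l₂ : List α) (h₁ : l₁.Nodup) (h₂ : l₂.Nodup)
    (h : l₁.filter (· ∈ l₂) = l₂.filter (· ∈ l₁)) :
    ∃ l : List α, l.Nodup ∧ (∀ x, x ∈ l ↔ x ∈ l₁ ∨ x ∈ l₂) ∧ l₁.Sublist l ∧ l₂.Sublist l := by
  have key : ∀ (x : α) (t l : List α), x ∉ l →
      l.filter (· ∈ x :: t) = l.filter (· ∈ t) := by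
    intro x t l hx
    refine List.filter_congr fun y hy => ?_
    have : y ≠ x := by rintro rfl; exact hx hy
    simp [this]
  have step : ∀ n, ∀ l₁ l₂ : List α, l₁.length + l₂.length ≤ n → l₁.Nodup → l₂.Nodup →
      l₁.filter (· ∈ l₂) = l₂.filter (· ∈ l₁) →
      ∃ l : List α, l.Nodup ∧ (∀ x, x ∈ l ↔ x ∈ l₁ ∨ x ∈ l₂) ∧ l₁.Sublist l ∧ l₂.Sublist l := by
    intro n
    induction n with
    | zero =>
      intro l₁ l₂ hn _ _ _
      obtain ⟨rfl, rfl⟩ : l₁ = [] ∧ l₂ = [] := by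
        simpa [List.length_eq_zero_iff] using hn
      exact ⟨[], by simp⟩
    | succ n ih =>
      have one : ∀ (x : α) (t l₂ : List α), (x :: t).length + l₂.length ≤ n + 1 → (x :: t).Nodup → l₂.Nodup →
          (x :: t).filter (· ∈ l₂) = l₂.filter (· ∈ x :: t) → x ∉ l₂ →
          ∃ l : List α, l.Nodup ∧ (∀ y, y ∈ l ↔ y ∈ x :: t ∨ y ∈ l₂) ∧
            (x :: t).Sublist l ∧ l₂.Sublist l := by
        intro x t l₂ hn h₁ h₂ h hx
        rw [List.nodup_cons] at h₁
        rw [key x t l₂ hx, List.filter_cons_of_neg (by simpa using hx)] at h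
        obtain ⟨l, hl, hm, hs₁, hs₂⟩ := ih t l₂ (by simp at hn; omega) h₁.2 h₂ h
        refine ⟨x :: l, List.nodup_cons.2 ⟨by rw [hm]; tauto, hl⟩, fun y => ?_,
          hs₁.cons_cons x, hs₂.cons x⟩
        simp only [List.mem_cons, hm]
        tauto
      intro l₁ l₂ hn h₁ h₂ h
      rcases l₁ with _ | ⟨x, t⟩
      · exact ⟨l₂, h₂, by simp, List.nil_sublist _, List.Sublist.refl _⟩
      by_cases hx : x ∈ l₂
      · rcases l₂ with _ | ⟨y, s⟩
        · simp at hx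
        by_cases hy : y ∈ x :: t
        · rw [List.filter_cons_of_pos (by simpa using hx),
            List.filter_cons_of_pos (by simpa using hy), List.cons.injEq] at h
          obtain ⟨rfl, h⟩ := h
          rw [List.nodup_cons] at h₁ h₂
          rw [key x s t h₁.1, key x t s h₂.1] at h
          obtain ⟨l, hl, hm, hs₁, hs₂⟩ := ih t s (by simp at hn; omega) h₁.2 h₂.2 h
          refine ⟨x :: l, List.nodup_cons.2 ⟨by rw [hm]; tauto, hl⟩, fun y => ?_,
            hs₁.cons_cons x, hs₂.cons_cons x⟩
          simp only [List.mem_cons, hm]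
          tauto
        · obtain ⟨l, hl, hm, hs₁, hs₂⟩ :=
            one y s (x :: t) (by rw [add_comm]; exact hn) h₂ h₁ h.symm hy
          exact ⟨l, hl, fun z => (hm z).trans or_comm, hs₂, hs₁⟩
      · exact one x t l₂ hn h₁ h₂ h hx
  exact step _ l₁ l₂ le_rfl h₁ h₂ h

theorem exists_merge_of_sublist {l₀ l₁ l₂ : List α} (h₁ : l₁.Nodup) (h₂ : l₂.Nodup)
    (hs₁ : l₀.Sublist l₁) (hs₂ : l₀.Sublist l₂) (h : ∀ x ∈ l₁, x ∈ l₂ → x ∈ l₀) :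
    ∃ l : List α, l.Nodup ∧ (∀ x, x ∈ l ↔ x ∈ l₁ ∨ x ∈ l₂) ∧ l₁.Sublist l ∧ l₂.Sublist l := by
  refine exists_merge l₁ l₂ h₁ h₂ ?_
  rw [← hs₁.eq_filter_mem h₁ (p := (· ∈ l₂)) fun x hx => ⟨fun h' => hs₂.subset h', h x hx⟩,
    ← hs₂.eq_filter_mem h₂ (p := (· ∈ l₁)) fun x hx => ⟨fun h' => hs₁.subset h', fun h' => h x h' hx⟩]

theorem possOrd_inter_of_notMem {σ : List α} {a : α} {J : Finset α} (ha : a ∉ J) :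
    possOrd σ ({a} ∩ J) = {σ} := by
  simp [possOrd, Finset.singleton_inter_of_notMem ha]

theorem mem_possOrd_inter_of_mem {σ σ' : List α} {a : α} {J : Finset α} (ha : a ∈ J) :
    σ' ∈ possOrd σ ({a} ∩ J) ↔ ∃ l l', σ = l ++ l' ∧ σ' = l ++ a :: l' := by
  simp only [possOrd, Finset.singleton_inter_of_mem ha, Finset.singleton_ne_empty, if_false,
    Finset.empty_union, Finset.singleton_biUnion, Finset.mem_image, Finset.mem_range]
  constructor
  · rintro ⟨i, hi, rfl⟩
    refine ⟨σ.take i, σ.drop i, (List.take_append_drop i σ).symm, ?_⟩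
    conv_lhs => rw [← List.take_append_drop i σ]
    have h : (σ.take i).length = i := List.length_take_of_le (by omega)
    generalize σ.take i = l at h
    subst h
    exact insertIdx_length_append _ _ _
  · rintro ⟨l, l', rfl, rfl⟩
    exact ⟨l.length, by simp, insertIdx_length_append _ _ _⟩

/-- Inserting a fresh atom keeps the other atoms in order. -/
theorem possOrd_spec {σ σ' : List α} {a : α} {J : Finset α} (hσ : σ.Nodup) (ha : a ∉ σ)
    (h : σ' ∈ possOrd σ ({a} ∩ J)) :
    σ'.Nodup ∧ σ.Sublist σ' ∧ ∀ x, x ∈ σ' ↔ x ∈ σ ∨ (x = a ∧ a ∈ J) := by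
  by_cases haJ : a ∈ J
  · obtain ⟨l, l', rfl, rfl⟩ := (mem_possOrd_inter_of_mem haJ).1 h
    refine ⟨?_, ?_, ?_⟩
    · rw [List.nodup_middle, List.nodup_cons]
      exact ⟨ha, hσ⟩
    · exact List.Sublist.append_left (List.sublist_cons_self a l') l
    · intro x
      simp only [List.mem_append, List.mem_cons]
      tauto
  · rw [possOrd_inter_of_notMem haJ, Finset.mem_singleton] at h
    subst h
    exact ⟨hσ, List.Sublist.refl _, by simp [haJ]⟩

/-- Used for completeness at introduce nodes: the global order `σ` dictates where `a` is inserted.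
-/
theorem filter_insert_mem_possOrd {σ : List α} {a : α} {B J : Finset α} (hσ : σ.Nodup)
    (haB : a ∉ B) (haJ : a ∈ J ↔ a ∈ σ) :
    σ.filter (· ∈ insert a B) ∈ possOrd (σ.filter (· ∈ B)) ({a} ∩ J) := by
  have key : ∀ l : List α, a ∉ l → l.filter (· ∈ insert a B) = l.filter (· ∈ B) := by
    intro l hl
    refine List.filter_congr fun x hx => ?_
    have : x ≠ a := by rintro rfl; exact hl hx
    simp [this]
  by_cases ha : a ∈ σ
  · rw [mem_possOrd_inter_of_mem (haJ.2 ha)]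
    obtain ⟨l, l', rfl⟩ := List.append_of_mem ha
    rw [List.nodup_middle, List.nodup_cons, List.mem_append, not_or] at hσ
    refine ⟨l.filter (· ∈ B), l'.filter (· ∈ B), ?_, ?_⟩
    · rw [List.filter_append, List.filter_cons_of_neg (by simpa using haB)]
    · rw [List.filter_append, List.filter_cons_of_pos (by simp), key l hσ.1.1, key l' hσ.1.2]
  · rw [possOrd_inter_of_notMem (fun h => ha (haJ.1 h)), key σ ha, Finset.mem_singleton]

end Lists

/-! ### The table algorithm PHC on single rows -/

variable {α ι : Type*} [DecidableEq α]

theorem mem_phc_introduce {prog : Program α} {a : α} {x : ι} {c : TTree α ι} (ha : a ∉ c.bag)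
    {τ : Table α} {u : Row α} :
    u ∈ phc prog (.unary (insert a c.bag) x c) [τ] ↔
      ∃ s ∈ τ, ∃ J, (J = s.interp ∨ J = insert a s.interp) ∧
        IsModel (bagProgram prog (insert a c.bag)) J ∧ ∃ σ ∈ possOrd s.order ({a} ∩ J),
          u = ⟨J, s.proven ∪ gatherProof J σ (bagProgram prog (insert a c.bag)), σ⟩ := by
  have h1 : TTree.IsInt (insert a c.bag) c.bag :=
    ⟨Finset.subset_insert a _, Finset.card_insert_of_notMem ha⟩
  have h2 : insert a c.bag \ c.bag = {a} := by
    rw [Finset.insert_sdiff_of_notMem _ ha, Finset.sdiff_self]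
    rfl
  simp only [phc, if_pos h1, h2, Finset.singleton_biUnion, phcInt, Finset.mem_biUnion,
    Finset.mem_filter, Finset.mem_insert, Finset.mem_singleton, Finset.mem_image]
  constructor
  · rintro ⟨s, hs, J, ⟨hJ, hm⟩, σ, hσ, rfl⟩
    exact ⟨s, hs, J, hJ, hm, σ, hσ, rfl⟩
  · rintro ⟨s, hs, J, hJ, hm, σ, hσ, rfl⟩
    exact ⟨s, hs, J, ⟨hJ, hm⟩, σ, hσ, rfl⟩

theorem mem_phc_removal {prog : Program α} {a : α} {x : ι} {c : TTree α ι} (ha : a ∈ c.bag)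
    {τ : Table α} {u : Row α} :
    u ∈ phc prog (.unary (c.bag.erase a) x c) [τ] ↔
      ∃ s ∈ τ, (a ∈ s.proven ∨ a ∉ s.interp) ∧
        u = ⟨s.interp.erase a, s.proven.erase a, s.order.erase a⟩ := by
  have hcard := Finset.card_erase_add_one ha
  have h1 : ¬ TTree.IsInt (c.bag.erase a) c.bag := fun h => by
    have := h.2
    omega
  have h2 : TTree.IsRem (c.bag.erase a) c.bag := ⟨Finset.erase_subset _ _, hcard.symm⟩
  have h3 : c.bag \ c.bag.erase a = {a} := by
    rw [Finset.sdiff_erase_self ha]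
  simp only [phc, if_neg h1, if_pos h2, h3, Finset.singleton_biUnion, phcRem, Finset.mem_image,
    Finset.mem_filter, Finset.mem_union, Finset.mem_sdiff, Finset.mem_singleton, true_and]
  constructor
  · rintro ⟨s, ⟨hs, hp⟩, rfl⟩
    exact ⟨s, hs, hp, rfl⟩
  · rintro ⟨s, hs, hp, rfl⟩
    exact ⟨s, ⟨hs, hp⟩, rfl⟩

theorem mem_phc_join {prog : Program α} {b : Finset α} {x : ι} {l r : TTree α ι}
    (hl : l.bag = b) (hr : r.bag = b) (hb : b ≠ ∅) {τ₁ τ₂ : Table α} {u : Row α} :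
    u ∈ phc prog (.binary b x l r) [τ₁, τ₂] ↔
      ∃ s₁ ∈ τ₁, ∃ s₂ ∈ τ₂, s₁.interp = s₂.interp ∧ s₁.order = s₂.order ∧
        u = ⟨s₁.interp, s₁.proven ∪ s₂.proven, s₁.order⟩ := by
  have h : TTree.IsJoin b l.bag r.bag := ⟨hl.symm, hr.symm, hb⟩
  simp only [phc, if_pos h, phcJoin, Finset.mem_image, Finset.mem_filter, Finset.mem_product,
    Prod.exists]
  constructor
  · rintro ⟨s₁, s₂, ⟨⟨h1, h2⟩, h3, h4⟩, rfl⟩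
    exact ⟨s₁, h1, s₂, h2, h3, h4, rfl⟩
  · rintro ⟨s₁, h1, s₂, h2, h3, h4, rfl⟩
    exact ⟨s₁, s₂, ⟨⟨h1, h2⟩, h3, h4⟩, rfl⟩

/-- The interpretations of atoms below the root that give rise to the row `u` of the root. -/
def sols (prog : Program α) : TTree α ι → Row α → Set (Finset α)
  | .leaf b x, u => {I | u ∈ phc prog (.leaf b x) [] ∧ I = ∅}
  | .unary b x c, u => {I | ∃ s, u ∈ phc prog (.unary b x c) [{s}] ∧
      ∃ I' ∈ sols prog c s, I = I' ∪ u.interp}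
  | .binary b x l r, u => {I | ∃ s₁ s₂, u ∈ phc prog (.binary b x l r) [{s₁}, {s₂}] ∧
      ∃ I₁ ∈ sols prog l s₁, ∃ I₂ ∈ sols prog r s₂, I = I₁ ∪ I₂}

theorem mem_sols_leaf {prog : Program α} {b : Finset α} {x : ι} {u : Row α} {I : Finset α} :
    I ∈ sols prog (.leaf b x) u ↔ u = Row.empty α ∧ I = ∅ := by
  simp [sols, phc]

theorem mem_sols_introduce {prog : Program α} {a : α} {x : ι} {c : TTree α ι} (ha : a ∉ c.bag)
    {u : Row α} {I : Finset α} :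
    I ∈ sols prog (.unary (insert a c.bag) x c) u ↔
      ∃ s J, (J = s.interp ∨ J = insert a s.interp) ∧
        IsModel (bagProgram prog (insert a c.bag)) J ∧ ∃ σ ∈ possOrd s.order ({a} ∩ J),
          u = ⟨J, s.proven ∪ gatherProof J σ (bagProgram prog (insert a c.bag)), σ⟩ ∧
          ∃ I' ∈ sols prog c s, I = I' ∪ J := by
  simp only [sols, Set.mem_ofPred_eq, mem_phc_introduce ha, Finset.mem_singleton]
  constructor
  · rintro ⟨_, ⟨s, rfl, J, hJ, hm, σ, hσ, rfl⟩, I', hI', rfl⟩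
    exact ⟨s, J, hJ, hm, σ, hσ, rfl, I', hI', rfl⟩
  · rintro ⟨s, J, hJ, hm, σ, hσ, rfl, I', hI', rfl⟩
    exact ⟨s, ⟨s, rfl, J, hJ, hm, σ, hσ, rfl⟩, I', hI', rfl⟩

theorem mem_sols_removal {prog : Program α} {a : α} {x : ι} {c : TTree α ι} (ha : a ∈ c.bag)
    {u : Row α} {I : Finset α} :
    I ∈ sols prog (.unary (c.bag.erase a) x c) u ↔
      ∃ s, (a ∈ s.proven ∨ a ∉ s.interp) ∧
        u = ⟨s.interp.erase a, s.proven.erase a, s.order.erase a⟩ ∧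
        ∃ I' ∈ sols prog c s, I = I' ∪ s.interp.erase a := by
  simp only [sols, Set.mem_ofPred_eq, mem_phc_removal ha, Finset.mem_singleton]
  constructor
  · rintro ⟨_, ⟨s, rfl, hp, rfl⟩, I', hI', rfl⟩
    exact ⟨s, hp, rfl, I', hI', rfl⟩
  · rintro ⟨s, hp, rfl, I', hI', rfl⟩
    exact ⟨s, ⟨s, rfl, hp, rfl⟩, I', hI', rfl⟩

theorem mem_sols_join {prog : Program α} {b : Finset α} {x : ι} {l r : TTree α ι}
    (hl : l.bag = b) (hr : r.bag = b) (hb : b ≠ ∅) {u : Row α} {I : Finset α} :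
    I ∈ sols prog (.binary b x l r) u ↔
      ∃ s₁ s₂, s₁.interp = s₂.interp ∧ s₁.order = s₂.order ∧
        u = ⟨s₁.interp, s₁.proven ∪ s₂.proven, s₁.order⟩ ∧
        ∃ I₁ ∈ sols prog l s₁, ∃ I₂ ∈ sols prog r s₂, I = I₁ ∪ I₂ := by
  simp only [sols, Set.mem_ofPred_eq, mem_phc_join hl hr hb, Finset.mem_singleton]
  constructor
  · rintro ⟨_, _, ⟨s₁, rfl, s₂, rfl, h1, h2, rfl⟩, I₁, hI₁, I₂, hI₂, rfl⟩
    exact ⟨s₁, s₂, h1, h2, rfl, I₁, hI₁, I₂, hI₂, rfl⟩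
  · rintro ⟨s₁, s₂, h1, h2, rfl, I₁, hI₁, I₂, hI₂, rfl⟩
    exact ⟨s₁, s₂, ⟨s₁, rfl, s₂, rfl, h1, h2, rfl⟩, I₁, hI₁, I₂, hI₂, rfl⟩

theorem dpPHC_unary_tab (prog : Program α) (b : Finset α) (x : ι) (c : TTree α ι) :
    (dpPHC prog (.unary b x c)).tab = phc prog (.unary b x c) [(dpPHC prog c).tab] := rfl

theorem dpPHC_binary_tab (prog : Program α) (b : Finset α) (x : ι) (l r : TTree α ι) :
    (dpPHC prog (.binary b x l r)).tab =
      phc prog (.binary b x l r) [(dpPHC prog l).tab, (dpPHC prog r).tab] := rfl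

/-- `phc` treats the input rows one by one (in pairs at a join), so the stored rows are those whose
origins can be followed down to the leaves. -/
theorem mem_dpPHC_tab {prog : Program α} {T : TTree α ι} (hT : T.NiceTree) {u : Row α} :
    u ∈ (dpPHC prog T).tab ↔ ∃ I, I ∈ sols prog T u := by
  induction hT generalizing u with
  | leaf x => simp [mem_sols_leaf, dpPHC, TTree.dp, TTree.tab, phc]
  | introduce a x c ha hc ih =>
    have hab : a ∉ c.bag := fun h => ha (c.bag_subset_cover h)
    rw [dpPHC_unary_tab]
    simp only [mem_phc_introduce hab, mem_sols_introduce hab, ih]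
    constructor
    · rintro ⟨s, ⟨I, hI⟩, J, hJ, hm, σ, hσ, rfl⟩
      exact ⟨_, s, J, hJ, hm, σ, hσ, rfl, I, hI, rfl⟩
    · rintro ⟨_, s, J, hJ, hm, σ, hσ, rfl, I, hI, rfl⟩
      exact ⟨s, ⟨I, hI⟩, J, hJ, hm, σ, hσ, rfl⟩
  | removal a x c ha hc ih =>
    rw [dpPHC_unary_tab]
    simp only [mem_phc_removal ha, mem_sols_removal ha, ih]
    constructor
    · rintro ⟨s, ⟨I, hI⟩, hp, rfl⟩
      exact ⟨_, s, hp, rfl, I, hI, rfl⟩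
    · rintro ⟨_, s, hp, rfl, I, hI, rfl⟩
      exact ⟨s, ⟨I, hI⟩, hp, rfl⟩
  | join b x l r hbl hbr hb hlr hl hr ihl ihr =>
    rw [dpPHC_binary_tab]
    simp only [mem_phc_join hbl hbr hb, mem_sols_join hbl hbr hb, ihl, ihr]
    constructor
    · rintro ⟨s₁, ⟨I₁, h₁⟩, s₂, ⟨I₂, h₂⟩, h3, h4, rfl⟩
      exact ⟨_, s₁, s₂, h3, h4, rfl, I₁, h₁, I₂, h₂, rfl⟩
    · rintro ⟨_, s₁, s₂, h3, h4, rfl, I₁, h₁, I₂, h₂, rfl⟩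
      exact ⟨s₁, ⟨I₁, h₁⟩, s₂, ⟨I₂, h₂⟩, h3, h4, rfl⟩

/-- The interpretations of a row are interpretations of atoms below, and the interpretation part of
the row is their restriction to the bag. -/
theorem sols_spec {prog : Program α} {T : TTree α ι} (hT : T.NiceTree) {u : Row α} {I : Finset α}
    (hI : I ∈ sols prog T u) : I ⊆ T.cover ∧ u.interp = I ∩ T.bag := by
  induction hT generalizing u I with
  | leaf x =>
    obtain ⟨rfl, rfl⟩ := mem_sols_leaf.1 hI
    simp [Row.empty]
  | introduce a x c ha hc ih =>
    have hab : a ∉ c.bag := fun h => ha (c.bag_subset_cover h)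
    obtain ⟨s, J, hJ, -, σ, -, rfl, I', hI', rfl⟩ := (mem_sols_introduce hab).1 hI
    obtain ⟨h1, h2⟩ := ih hI'
    have haI : a ∉ I' := fun h => ha (h1 h)
    have hbc := c.bag_subset_cover
    simp only [TTree.cover_unary, TTree.bag_unary]
    constructor
    · intro v
      rcases hJ with rfl | rfl <;> rw [h2] <;> simp <;> grind
    · ext v
      rcases hJ with rfl | rfl <;> rw [h2] <;> simp <;> grind
  | removal a x c ha hc ih =>
    obtain ⟨s, -, rfl, I', hI', rfl⟩ := (mem_sols_removal ha).1 hI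
    obtain ⟨h1, h2⟩ := ih hI'
    have hbc := c.bag_subset_cover
    simp only [TTree.cover_unary, TTree.bag_unary]
    constructor
    · intro v
      rw [h2]; simp; grind
    · ext v
      rw [h2]; simp; grind
  | join b x l r hbl hbr hb hlr hl hr ihl ihr =>
    obtain ⟨s₁, s₂, he, -, rfl, I₁, hI₁, I₂, hI₂, rfl⟩ := (mem_sols_join hbl hbr hb).1 hI
    obtain ⟨h1, h2⟩ := ihl hI₁
    obtain ⟨h3, h4⟩ := ihr hI₂
    simp only [TTree.cover_binary, TTree.bag_binary]
    refine ⟨Finset.union_subset (h1.trans ?_) (h3.trans ?_), ?_⟩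
    · exact Finset.subset_union_left.trans Finset.subset_union_right
    · exact Finset.subset_union_right.trans Finset.subset_union_right
    · rw [Finset.union_inter_distrib_right]
      subst hbl
      rw [hbr] at h4
      rw [← h2, ← h4, ← he, Finset.union_self]

theorem Rule.sat_congr {r : Rule α} {I J : Finset α} (h : ∀ v ∈ r.atoms, v ∈ I ↔ v ∈ J) :
    r.Sat I ↔ r.Sat J := by
  have h' : ∀ v, v ∈ r.head ∨ v ∈ r.posBody ∨ v ∈ r.negBody → (v ∈ I ↔ v ∈ J) := fun v hv =>
    h v (by simp only [Rule.atoms, Finset.mem_union]; tauto)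
  have h1 : (r.head ∪ r.negBody) ∩ I = (r.head ∪ r.negBody) ∩ J := by
    ext v
    have := h' v
    simp only [Finset.mem_inter, Finset.mem_union]
    tauto
  have h2 : r.posBody \ I = r.posBody \ J := by
    ext v
    have := h' v
    simp only [Finset.mem_sdiff]
    tauto
  rw [Rule.Sat, Rule.Sat, h1, h2]

/-- Only precedences inside the rule must be preserved, so a proof passes both to a longer merged
order and to the restriction to a bag containing the rule. -/
theorem Rule.Proves.congr {r : Rule α} {I J : Finset α} {σ σ' : List α} {c : α}
    (h : r.Proves I σ c) (hIJ : ∀ v ∈ r.atoms, v ∈ I ↔ v ∈ J)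
    (hσ : ∀ b ∈ r.atoms, [b, c].Sublist σ → [b, c].Sublist σ') : r.Proves J σ' c := by
  have h' : ∀ v, v ∈ r.head ∨ v ∈ r.posBody ∨ v ∈ r.negBody → (v ∈ I ↔ v ∈ J) := fun v hv =>
    hIJ v (by simp only [Rule.atoms, Finset.mem_union]; tauto)
  obtain ⟨h1, h2, h3, h4, h5⟩ := h
  refine ⟨h1, fun b hb => (h' b (by tauto)).1 (h2 hb), ?_, ?_, fun b hb => hσ b ?_ (h5 b hb)⟩
  · rw [← h3]
    ext v
    have := h' v
    simp only [Finset.mem_inter]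
    tauto
  · rw [← h4]
    ext v
    have := h' v
    simp only [Finset.mem_inter, Finset.mem_sdiff]
    tauto
  · simp only [Rule.atoms, Finset.mem_union]; tauto

theorem Rule.Proves.mem_atoms {r : Rule α} {I : Finset α} {σ : List α} {c : α}
    (h : r.Proves I σ c) : c ∈ r.atoms := by
  simp only [Rule.atoms, Finset.mem_union]
  exact Or.inl (Or.inl h.1)

end Rows

/-! ### Rows at the root correspond to answer sets -/

section Correctness

variable {α ι : Type*} [DecidableEq α]

/-! ### Soundness and completeness of PHC -/

theorem mem_bagProgram {prog : Program α} {b : Finset α} {r : Rule α} :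
    r ∈ bagProgram prog b ↔ r ∈ prog ∧ r.atoms ⊆ b := by
  simp [bagProgram]

/-- The sequence `σ` of the atoms of `I` witnesses that `I` gives rise to the row `u` of the root:
the rules below are satisfied, and the proven atoms and the removed atoms have proofs. -/
structure IsWitness (prog : Program α) (T : TTree α ι) (u : Row α) (I : Finset α)
    (σ : List α) : Prop where
  nodup : σ.Nodup
  mem_iff : ∀ c, c ∈ σ ↔ c ∈ I
  order : u.order = σ.filter (· ∈ T.bag)
  sat : ∀ r ∈ prog, ∀ B ∈ T.bags, r.atoms ⊆ B → T.cover.Nonempty → r.Sat I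
  proven : ∀ c ∈ u.proven, c ∈ T.bag ∧ ∃ r ∈ prog, r.atoms ⊆ T.cover ∧ r.Proves I σ c
  removed : ∀ c ∈ I, c ∉ T.bag → ∃ r ∈ prog, r.atoms ⊆ T.cover ∧ r.Proves I σ c

theorem TTree.subset_cover_of_mem_bags {T : TTree α ι} {B : Finset α} (hB : B ∈ T.bags) :
    B ⊆ T.cover := fun _ hv => TTree.mem_cover.2 ⟨B, hB, hv⟩

/-- The order from below and the order of the new row both extend `s.order` and share no other
atoms, `a` being fresh; hence they merge. Rules below do not mention `a`, so enlarging `I'` does not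
affect them. -/
theorem exists_isWitness_introduce {prog : Program α} {a : α} {x : ι} {c : TTree α ι}
    (ha : a ∉ c.cover) (hc : c.NiceTree)
    (ih : ∀ {u I}, I ∈ sols prog c u → ∃ σ, IsWitness prog c u I σ) {u : Row α} {I : Finset α}
    (hI : I ∈ sols prog (.unary (insert a c.bag) x c) u) :
    ∃ σ, IsWitness prog (.unary (insert a c.bag) x c) u I σ := by
  have hab : a ∉ c.bag := fun h => ha (c.bag_subset_cover h)
  have hspec := sols_spec (hc.introduce a x c ha) hI
  obtain ⟨s, J, hJ, hmod, σJ, hσJ, rfl, I', hI', rfl⟩ := (mem_sols_introduce hab).1 hI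
  obtain ⟨h1, h2⟩ := sols_spec hc hI'
  obtain ⟨σ', w⟩ := ih hI'
  have haI : a ∉ I' := fun h => ha (h1 h)
  have has : a ∉ s.order := by
    rw [w.order, List.mem_filter, w.mem_iff]
    exact fun h => haI h.1
  have hs : ∀ v, v ∈ s.order ↔ v ∈ I' ∧ v ∈ c.bag := fun v => by
    rw [w.order, List.mem_filter, w.mem_iff, decide_eq_true_iff]
  have hJv : ∀ v, v ∈ J ↔ (v ∈ I' ∧ v ∈ c.bag) ∨ (v = a ∧ a ∈ J) := by
    intro v
    rcases hJ with rfl | rfl <;> simp only [h2, Finset.mem_insert, Finset.mem_inter] <;> grind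
  obtain ⟨hJn, hJs, hJm⟩ := possOrd_spec (w.order ▸ w.nodup.filter _) has hσJ
  obtain ⟨σ, hn, hm, hs1, hs2⟩ := exists_merge_of_sublist w.nodup hJn
    (w.order ▸ List.filter_sublist) hJs (by
      intro v hv hvJ
      rw [hJm] at hvJ
      rw [w.mem_iff] at hv
      exact hvJ.resolve_right fun h => haI (h.1 ▸ hv))
  have hbagJ : ∀ v ∈ insert a c.bag, v ∈ J ↔ v ∈ I' ∪ J := by
    intro v hv
    have hspec' : J = (I' ∪ J) ∩ insert a c.bag := hspec.2
    exact ⟨Finset.mem_union_right _, fun h => hspec' ▸ Finset.mem_inter.2 ⟨h, hv⟩⟩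
  have hcov : ∀ v ∈ c.cover, v ∈ I' ↔ v ∈ I' ∪ J := by
    intro v hv
    have hva : v ≠ a := by rintro rfl; exact ha hv
    have := hJv v
    rw [Finset.mem_union]
    grind
  have hlift : ∀ r : Rule α, ∀ d, r.atoms ⊆ c.cover → r.Proves I' σ' d →
      r.Proves (I' ∪ J) σ d := fun r d hr hp =>
    hp.congr (fun v hv => hcov v (hr hv)) fun b _ h => h.trans hs1
  have hsub : c.cover ⊆ (TTree.unary (insert a c.bag) x c).cover :=
    Finset.subset_union_right
  have hroot : ∀ r ∈ prog, r.atoms ⊆ insert a c.bag → r.Sat (I' ∪ J) := fun r hr hra =>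
    (Rule.sat_congr fun v hv => hbagJ v (hra hv)).1 (hmod r (mem_bagProgram.2 ⟨hr, hra⟩))
  refine ⟨σ, hn, ?_, ?_, ?_, ?_, ?_⟩
  · intro v
    rw [hm, w.mem_iff, hJm, hs, Finset.mem_union, hJv v]
  · refine hs2.eq_filter_mem hn fun v hv => ?_
    have h3 := hJm v
    have h4 := hs v
    rw [hm, w.mem_iff] at hv
    simp only [TTree.bag_unary, Finset.mem_insert]
    constructor
    · intro h
      exact (h3.1 h).elim (fun h => Or.inr (h4.1 h).2) fun h => Or.inl h.1
    · rintro (rfl | h)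
      · exact hv.resolve_left haI
      · exact hv.elim (fun hI => h3.2 (Or.inl (h4.2 ⟨hI, h⟩))) id
  · intro r hr B hB hrB _
    rcases List.mem_cons.1 hB with rfl | hB
    · exact hroot r hr hrB
    -- A leaf checks no rule, so `w.sat` is void when no atom occurs below. Then `r` has no atoms
    -- and is checked at this node.
    · rcases c.cover.eq_empty_or_nonempty with he | hne
      · refine hroot r hr ?_
        have := hrB.trans (TTree.subset_cover_of_mem_bags hB)
        rw [he, Finset.subset_empty] at this
        rw [this]
        exact Finset.empty_subset _
      · exact (Rule.sat_congr fun v hv =>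
          hcov v (TTree.subset_cover_of_mem_bags hB (hrB hv))).1 (w.sat r hr B hB hrB hne)
  · intro d hd
    rcases Finset.mem_union.1 hd with hd | hd
    · obtain ⟨h3, r, hr, hra, hp⟩ := w.proven d hd
      exact ⟨Finset.mem_insert_of_mem h3, r, hr, hra.trans hsub, hlift r d hra hp⟩
    · obtain ⟨r, hr, hp⟩ := mem_gatherProof.1 hd
      obtain ⟨hr, hra⟩ := mem_bagProgram.1 hr
      exact ⟨hra hp.mem_atoms, r, hr, hra.trans Finset.subset_union_left,
        hp.congr (fun v hv => hbagJ v (hra hv)) fun b _ h => h.trans hs2⟩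
  · intro d hd hdb
    simp only [TTree.bag_unary, Finset.mem_insert, not_or] at hdb
    have h5 := hJv d
    rw [Finset.mem_union] at hd
    obtain ⟨r, hr, hra, hp⟩ := w.removed d (hd.elim id fun h =>
      (h5.1 h).elim And.left fun h => absurd h.1 hdb.1) hdb.2
    exact ⟨r, hr, hra.trans hsub, hlift r d hra hp⟩

/-- The interpretation and its order stay the same. The filter on rows ensures that `a`, if true,
has a proof, which now counts among those of the removed atoms. -/
theorem exists_isWitness_removal {prog : Program α} {a : α} {x : ι} {c : TTree α ι}
    (ha : a ∈ c.bag) (hc : c.NiceTree)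
    (ih : ∀ {u I}, I ∈ sols prog c u → ∃ σ, IsWitness prog c u I σ) {u : Row α} {I : Finset α}
    (hI : I ∈ sols prog (.unary (c.bag.erase a) x c) u) :
    ∃ σ, IsWitness prog (.unary (c.bag.erase a) x c) u I σ := by
  obtain ⟨s, hp, rfl, I', hI', rfl⟩ := (mem_sols_removal ha).1 hI
  obtain ⟨h1, h2⟩ := sols_spec hc hI'
  obtain ⟨σ, w⟩ := ih hI'
  have hII : I' ∪ s.interp.erase a = I' := by
    rw [Finset.union_eq_left, h2]
    exact (Finset.erase_subset _ _).trans Finset.inter_subset_left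
  rw [hII]
  have hsub : c.cover ⊆ (TTree.unary (c.bag.erase a) x c).cover :=
    Finset.subset_union_right
  have hne : c.cover.Nonempty := ⟨a, c.bag_subset_cover ha⟩
  refine ⟨σ, w.nodup, w.mem_iff, ?_, ?_, ?_, ?_⟩
  · simp only [w.order, TTree.bag_unary]
    rw [(w.nodup.filter _).erase_eq_filter, List.filter_filter]
    refine List.filter_congr fun v _ => ?_
    by_cases hva : v = a <;> simp [hva]
  · intro r hr B hB hrB _
    rcases List.mem_cons.1 hB with rfl | hB
    · exact w.sat r hr c.bag c.bag_mem_bags (hrB.trans (Finset.erase_subset _ _)) hne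
    · exact w.sat r hr B hB hrB hne
  · intro d hd
    simp only [Finset.mem_erase] at hd
    obtain ⟨h3, r, hr, hra, hpr⟩ := w.proven d hd.2
    exact ⟨Finset.mem_erase.2 ⟨hd.1, h3⟩, r, hr, hra.trans hsub, hpr⟩
  · intro d hd hdb
    simp only [TTree.bag_unary, Finset.mem_erase, not_and] at hdb
    by_cases hda : d = a
    · subst hda
      have : d ∈ s.proven := hp.resolve_right (by rw [h2]; simp [hd, ha])
      obtain ⟨-, r, hr, hra, hpr⟩ := w.proven d this
      exact ⟨r, hr, hra.trans hsub, hpr⟩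
    · obtain ⟨r, hr, hra, hpr⟩ := w.removed d hd (hdb hda)
      exact ⟨r, hr, hra.trans hsub, hpr⟩

/-- Atoms common to both sides lie in `b`, where the two interpretations and the two orders agree;
so the orders merge and neither side changes on its own atoms. -/
theorem exists_isWitness_join {prog : Program α} {b : Finset α} {x : ι} {l r : TTree α ι}
    (hbl : l.bag = b) (hbr : r.bag = b) (hb : b ≠ ∅) (hlr : l.cover ∩ r.cover ⊆ b)
    (hl : l.NiceTree) (hr : r.NiceTree)
    (ihl : ∀ {u I}, I ∈ sols prog l u → ∃ σ, IsWitness prog l u I σ)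
    (ihr : ∀ {u I}, I ∈ sols prog r u → ∃ σ, IsWitness prog r u I σ) {u : Row α} {I : Finset α}
    (hI : I ∈ sols prog (.binary b x l r) u) :
    ∃ σ, IsWitness prog (.binary b x l r) u I σ := by
  obtain ⟨s₁, s₂, he, ho, rfl, I₁, hI₁, I₂, hI₂, rfl⟩ := (mem_sols_join hbl hbr hb).1 hI
  obtain ⟨h1, h2⟩ := sols_spec hl hI₁
  obtain ⟨h3, h4⟩ := sols_spec hr hI₂
  obtain ⟨σ₁, w₁⟩ := ihl hI₁
  obtain ⟨σ₂, w₂⟩ := ihr hI₂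
  have ho₁ := w₁.order
  have ho₂ := w₂.order
  rw [hbl] at h2 ho₁
  rw [hbr] at h4 ho₂
  have hbag : ∀ v ∈ b, v ∈ I₁ ↔ v ∈ I₂ := by
    intro v hv
    have := congrArg (v ∈ ·) (h2.symm.trans (he.trans h4))
    simpa [hv] using this
  obtain ⟨σ, hn, hm, hs1, hs2⟩ := exists_merge_of_sublist (l₀ := s₁.order) w₁.nodup w₂.nodup
    (ho₁ ▸ List.filter_sublist) (ho ▸ ho₂ ▸ List.filter_sublist) (by
      intro v hv hv2
      rw [ho₁, List.mem_filter, decide_eq_true_iff]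
      exact ⟨hv, hlr (Finset.mem_inter.2
        ⟨h1 ((w₁.mem_iff v).1 hv), h3 ((w₂.mem_iff v).1 hv2)⟩)⟩)
  have hcov₁ : ∀ v ∈ l.cover, v ∈ I₁ ↔ v ∈ I₁ ∪ I₂ := by
    intro v hv
    rw [Finset.mem_union]
    refine ⟨Or.inl, fun h => h.elim id fun h => ?_⟩
    exact (hbag v (hlr (Finset.mem_inter.2 ⟨hv, h3 h⟩))).2 h
  have hcov₂ : ∀ v ∈ r.cover, v ∈ I₂ ↔ v ∈ I₁ ∪ I₂ := by
    intro v hv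
    rw [Finset.mem_union]
    refine ⟨Or.inr, fun h => h.elim (fun h => ?_) id⟩
    exact (hbag v (hlr (Finset.mem_inter.2 ⟨h1 h, hv⟩))).1 h
  have hlift₁ : ∀ d, (∃ q ∈ prog, q.atoms ⊆ l.cover ∧ q.Proves I₁ σ₁ d) →
      ∃ q ∈ prog, q.atoms ⊆ (TTree.binary b x l r).cover ∧ q.Proves (I₁ ∪ I₂) σ d := by
    rintro d ⟨q, hq, hqa, hp⟩
    exact ⟨q, hq, hqa.trans (Finset.subset_union_left.trans Finset.subset_union_right),
      hp.congr (fun v hv => hcov₁ v (hqa hv)) fun b _ h => h.trans hs1⟩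
  have hlift₂ : ∀ d, (∃ q ∈ prog, q.atoms ⊆ r.cover ∧ q.Proves I₂ σ₂ d) →
      ∃ q ∈ prog, q.atoms ⊆ (TTree.binary b x l r).cover ∧ q.Proves (I₁ ∪ I₂) σ d := by
    rintro d ⟨q, hq, hqa, hp⟩
    exact ⟨q, hq, hqa.trans (Finset.subset_union_right.trans Finset.subset_union_right),
      hp.congr (fun v hv => hcov₂ v (hqa hv)) fun b _ h => h.trans hs2⟩
  obtain ⟨v₀, hv₀⟩ := Finset.nonempty_iff_ne_empty.2 hb
  have hne₁ : l.cover.Nonempty := ⟨v₀, l.bag_subset_cover (hbl ▸ hv₀)⟩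
  have hne₂ : r.cover.Nonempty := ⟨v₀, r.bag_subset_cover (hbr ▸ hv₀)⟩
  have hsat₁ : ∀ q ∈ prog, ∀ B ∈ l.bags, q.atoms ⊆ B → q.Sat (I₁ ∪ I₂) := fun q hq B hB hqB =>
    (Rule.sat_congr fun v hv => hcov₁ v (TTree.subset_cover_of_mem_bags hB (hqB hv))).1
      (w₁.sat q hq B hB hqB hne₁)
  refine ⟨σ, hn, ?_, ?_, ?_, ?_, ?_⟩
  · intro v
    rw [hm, w₁.mem_iff, w₂.mem_iff, Finset.mem_union]
  · refine List.Sublist.eq_filter_mem ((ho₁ ▸ List.filter_sublist : s₁.order.Sublist σ₁).trans hs1)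
      hn fun v hv => ?_
    rw [hm, w₁.mem_iff, w₂.mem_iff] at hv
    have := hbag v
    simp only [ho₁, List.mem_filter, decide_eq_true_iff, w₁.mem_iff, TTree.bag_binary]
    tauto
  · intro q hq B hB hqB _
    simp only [TTree.bags, List.mem_cons, List.mem_append] at hB
    rcases hB with rfl | hB | hB
    · exact hsat₁ q hq l.bag l.bag_mem_bags (hbl ▸ hqB)
    · exact hsat₁ q hq B hB hqB
    · exact (Rule.sat_congr fun v hv =>
        hcov₂ v (TTree.subset_cover_of_mem_bags hB (hqB hv))).1 (w₂.sat q hq B hB hqB hne₂)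
  · intro d hd
    rcases Finset.mem_union.1 hd with hd | hd
    · have := w₁.proven d hd
      exact ⟨hbl ▸ this.1, hlift₁ d this.2⟩
    · have := w₂.proven d hd
      exact ⟨hbr ▸ this.1, hlift₂ d this.2⟩
  · intro d hd hdb
    rcases Finset.mem_union.1 hd with hd | hd
    · exact hlift₁ d (w₁.removed d hd (hbl ▸ hdb))
    · exact hlift₂ d (w₂.removed d hd (hbr ▸ hdb))

theorem exists_isWitness {prog : Program α} {T : TTree α ι} (hT : T.NiceTree) {u : Row α}
    {I : Finset α} (hI : I ∈ sols prog T u) : ∃ σ, IsWitness prog T u I σ := by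
  induction hT generalizing u I with
  | leaf x =>
    obtain ⟨rfl, rfl⟩ := mem_sols_leaf.1 hI
    exact ⟨[], by constructor <;> simp [Row.empty]⟩
  | introduce a x c ha hc ih => exact exists_isWitness_introduce ha hc ih hI
  | removal a x c ha hc ih => exact exists_isWitness_removal ha hc ih hI
  | join b x l r hbl hbr hb hlr hl hr ihl ihr =>
    exact exists_isWitness_join hbl hbr hb hlr hl hr ihl ihr hI

theorem sublist_filter_of_mem {σ : List α} {B : Finset α} {b c : α} (h : [b, c].Sublist σ)
    (hb : b ∈ B) (hc : c ∈ B) : [b, c].Sublist (σ.filter (· ∈ B)) := by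
  have := h.filter (fun x => decide (x ∈ B))
  simpa [List.filter, hb, hc] using this

/-- Restrict `I` and `σ` to every bag. The proven set `Q` is only bounded from below, which
suffices: `hloc` says that a rule containing an atom already removed fits into a bag of this
subtree, so an atom's proof has been collected by the time the atom is removed. -/
theorem IsProvenModel.exists_mem_sols {prog : Program α} {I : Finset α} {σ : List α}
    (h : IsProvenModel prog I σ) {T : TTree α ι} (hT : T.NiceTree)
    (hloc : ∀ r ∈ prog, ∀ v ∈ r.atoms, v ∈ T.cover → v ∉ T.bag → ∃ B ∈ T.bags, r.atoms ⊆ B) :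
    ∃ Q, I ∩ T.cover ∈ sols prog T ⟨I ∩ T.bag, Q, σ.filter (· ∈ T.bag)⟩ ∧
      ∀ r ∈ prog, ∀ B ∈ T.bags, r.atoms ⊆ B → ∀ c ∈ T.bag, r.Proves I σ c → c ∈ Q := by
  induction hT with
  | leaf x =>
    refine ⟨∅, mem_sols_leaf.2 ⟨?_, ?_⟩, ?_⟩ <;> simp [Row.empty]
  | introduce a x c ha hc ih =>
    have hab : a ∉ c.bag := fun h => ha (c.bag_subset_cover h)
    obtain ⟨Q, hQ, hQp⟩ := ih (by
      intro r hr v hv hvc hvb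
      have hva : v ≠ a := by rintro rfl; exact ha hvc
      have hvn : v ∉ insert a c.bag := by simp [hva, hvb]
      obtain ⟨B, hB, hrB⟩ := hloc r hr v hv (Finset.mem_union_right _ hvc) hvn
      rcases List.mem_cons.1 hB with rfl | hB
      · exact absurd (hrB hv) hvn
      · exact ⟨B, hB, hrB⟩)
    refine ⟨_, (mem_sols_introduce hab).2 ⟨_, I ∩ insert a c.bag, ?_, ?_,
      σ.filter (· ∈ insert a c.bag), ?_, rfl, _, hQ, ?_⟩, ?_⟩
    · by_cases haI : a ∈ I
      · right
        rw [Finset.inter_insert_of_mem haI]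
      · left
        rw [Finset.inter_insert_of_notMem haI]
    · intro r hr
      obtain ⟨hr, hra⟩ := mem_bagProgram.1 hr
      exact (Rule.sat_congr fun v hv => by simp [-Finset.mem_insert, hra hv]).1 (h.isModel r hr)
    · refine filter_insert_mem_possOrd h.nodup hab ?_
      rw [h.mem_iff]
      simp
    · have := c.bag_subset_cover
      simp only [TTree.cover_unary]
      rw [← Finset.inter_union_distrib_left, Finset.union_comm]
    · intro r hr B hB hrB d hd hp
      rcases List.mem_cons.1 hB with rfl | hBc
      · refine Finset.mem_union_right _ (mem_gatherProof.2
          ⟨r, mem_bagProgram.2 ⟨hr, hrB⟩, hp.congr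
            (fun v hv => by simp [-Finset.mem_insert, hrB hv]) fun b hb hs => ?_⟩)
        exact sublist_filter_of_mem hs (hrB hb) hd
      · refine Finset.mem_union_left _ (hQp r hr B hBc hrB d ?_ hp)
        refine Finset.mem_of_mem_insert_of_ne hd ?_
        rintro rfl
        exact ha (TTree.subset_cover_of_mem_bags hBc (hrB hp.mem_atoms))
  | removal a x c ha hc ih =>
    have hloc' : ∀ r ∈ prog, ∀ v ∈ r.atoms, v ∈ c.cover → v ∉ c.bag.erase a →
        ∃ B ∈ c.bags, r.atoms ⊆ B := by
      intro r hr v hv hvc hvb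
      obtain ⟨B, hB, hrB⟩ := hloc r hr v hv (Finset.mem_union_right _ hvc) hvb
      rcases List.mem_cons.1 hB with rfl | hB
      · exact absurd (hrB hv) hvb
      · exact ⟨B, hB, hrB⟩
    obtain ⟨Q, hQ, hQp⟩ := ih fun r hr v hv hvc hvb =>
      hloc' r hr v hv hvc fun h => hvb (Finset.mem_of_mem_erase h)
    refine ⟨Q.erase a, (mem_sols_removal ha).2 ⟨_, ?_, ?_, _, hQ, ?_⟩, ?_⟩
    · by_cases haI : a ∈ I
      · left
        obtain ⟨r, hr, hp⟩ := h.proves a haI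
        -- Since `a` is missing from the root bag, the rule that proves it fits into a bag of `c`,
        -- whence `a ∈ Q`.
        obtain ⟨B, hB, hrB⟩ := hloc' r hr a hp.mem_atoms (c.bag_subset_cover ha) (by simp)
        exact hQp r hr B hB hrB a ha hp
      · right
        simp [haI]
    · congr 1
      · ext v
        simp
        tauto
      · rw [(h.nodup.filter _).erase_eq_filter, List.filter_filter]
        refine List.filter_congr fun v _ => ?_
        by_cases hva : v = a <;> simp [hva]
    · have := c.bag_subset_cover
      simp only [TTree.cover_unary]
      ext v
      have := @this v
      simp only [Finset.mem_inter, Finset.mem_union, Finset.mem_erase]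
      tauto
    · intro r hr B hB hrB d hd hp
      have hd' := Finset.mem_erase.1 hd
      refine Finset.mem_erase.2 ⟨hd'.1, ?_⟩
      rcases List.mem_cons.1 hB with rfl | hB
      · exact hQp r hr c.bag c.bag_mem_bags (hrB.trans (Finset.erase_subset _ _)) d hd'.2 hp
      · exact hQp r hr B hB hrB d hd'.2 hp
  | join b x l r hbl hbr hb hlr hl hr ihl ihr =>
    obtain ⟨Q₁, hQ₁, hp₁⟩ := ihl (by
      intro q hq v hv hvc hvb
      rw [hbl] at hvb
      obtain ⟨B, hB, hqB⟩ := hloc q hq v hv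
        (Finset.mem_union_right _ (Finset.mem_union_left _ hvc)) hvb
      simp only [TTree.bags, List.mem_cons, List.mem_append] at hB
      rcases hB with rfl | hB | hB
      · exact absurd (hqB hv) hvb
      · exact ⟨B, hB, hqB⟩
      · exact absurd (hlr (Finset.mem_inter.2
          ⟨hvc, TTree.subset_cover_of_mem_bags hB (hqB hv)⟩)) hvb)
    obtain ⟨Q₂, hQ₂, hp₂⟩ := ihr (by
      intro q hq v hv hvc hvb
      rw [hbr] at hvb
      obtain ⟨B, hB, hqB⟩ := hloc q hq v hv
        (Finset.mem_union_right _ (Finset.mem_union_right _ hvc)) hvb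
      simp only [TTree.bags, List.mem_cons, List.mem_append] at hB
      rcases hB with rfl | hB | hB
      · exact absurd (hqB hv) hvb
      · exact absurd (hlr (Finset.mem_inter.2
          ⟨TTree.subset_cover_of_mem_bags hB (hqB hv), hvc⟩)) hvb
      · exact ⟨B, hB, hqB⟩)
    rw [hbl] at hQ₁
    rw [hbr] at hQ₂
    refine ⟨Q₁ ∪ Q₂, (mem_sols_join hbl hbr hb).2
      ⟨⟨I ∩ b, Q₁, σ.filter (· ∈ b)⟩, ⟨I ∩ b, Q₂, σ.filter (· ∈ b)⟩, rfl, rfl, rfl, _, hQ₁, _, hQ₂,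
        ?_⟩, ?_⟩
    · have := l.bag_subset_cover
      rw [hbl] at this
      rw [← Finset.inter_union_distrib_left, TTree.cover_binary, Finset.union_eq_right.2]
      exact this.trans Finset.subset_union_left
    · intro q hq B hB hqB d hd hp
      simp only [TTree.bags, List.mem_cons, List.mem_append] at hB
      rcases hB with rfl | hB | hB
      · exact Finset.mem_union_left _
          (hp₁ q hq l.bag l.bag_mem_bags (hbl ▸ hqB) d (hbl ▸ hd) hp)
      · exact Finset.mem_union_left _ (hp₁ q hq B hB hqB d (hbl ▸ hd) hp)
      · exact Finset.mem_union_right _ (hp₂ q hq B hB hqB d (hbr ▸ hd) hp)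

/-! ### The root -/

theorem eq_empty_of_mem_sols {prog : Program α} {T : TTree α ι} (hT : T.NiceTree)
    (hb : T.bag = ∅) {u : Row α} {I : Finset α} (hI : I ∈ sols prog T u) : u = Row.empty α := by
  obtain ⟨-, h1⟩ := sols_spec hT hI
  obtain ⟨σ, w⟩ := exists_isWitness hT hI
  have h2 := w.order
  have h3 : u.proven = ∅ := by
    rw [Finset.eq_empty_iff_forall_notMem]
    intro c hc
    have := (w.proven c hc).1
    rw [hb] at this
    exact Finset.notMem_empty c this
  rw [hb] at h1 h2
  rcases u with ⟨i, p, o⟩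
  simp only [Finset.inter_empty, Finset.notMem_empty, decide_false, List.filter_false] at h1 h2 h3
  rw [h1, h2, h3, Row.empty]

theorem Rule.eq_empty_of_atoms {r : Rule α} (h : r.atoms = ∅) : r = Rule.empty α := by
  rcases r with ⟨h1, h2, h3, _, _, _⟩
  simp only [Rule.atoms, Finset.union_eq_empty] at h
  obtain ⟨⟨rfl, rfl⟩, rfl⟩ := h
  rfl

/-- The root bag is empty, so all atoms of a solution have been removed and therefore proven, and
every rule has been checked in some bag. -/
theorem mem_sols_root_iff {prog : Program α} (hcf : HeadCycleFree prog)
    (hne : prog ≠ {Rule.empty α}) {T : TTree α ι} (hT : IsNiceTD prog T) {I : Finset α} :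
    I ∈ sols prog T (Row.empty α) ↔ IsAnswerSet prog I := by
  have hb : T.bag = ∅ := hT.2.2
  rw [isAnswerSet_iff_exists_isProvenModel hcf]
  constructor
  · intro hI
    obtain ⟨σ, w⟩ := exists_isWitness hT.niceTree hI
    refine ⟨σ, ?_, w.nodup, w.mem_iff, ?_⟩
    · intro r hr
      obtain ⟨B, hB, hrB⟩ := hT.exists_bag_of_mem hr
      refine w.sat r hr B hB hrB ?_
      -- This is where `hne` enters: without atoms there is no introduce node, and an empty rule
      -- would go unchecked.
      obtain ⟨q, hq, hqe⟩ : ∃ q ∈ prog, q.atoms ≠ ∅ := by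
        by_contra! hall
        refine hne (Finset.eq_singleton_iff_nonempty_unique_mem.2 ⟨⟨r, hr⟩, fun q hq => ?_⟩)
        exact Rule.eq_empty_of_atoms (hall q hq)
      obtain ⟨v, hv⟩ := Finset.nonempty_iff_ne_empty.2 hqe
      exact ⟨v, hT.cover_eq ▸ Finset.mem_biUnion.2 ⟨q, hq, hv⟩⟩
    · intro c hc
      obtain ⟨r, hr, -, hp⟩ := w.removed c hc (by simp [hb])
      exact ⟨r, hr, hp⟩
  · rintro ⟨σ, h⟩
    obtain ⟨Q, hQ, -⟩ := h.exists_mem_sols hT.niceTree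
      fun r hr _ _ _ _ => hT.exists_bag_of_mem hr
    have hI : I ∩ T.cover = I := by
      rw [Finset.inter_eq_left, hT.cover_eq]
      intro c hc
      obtain ⟨r, hr, hp⟩ := h.proves c hc
      exact Finset.mem_biUnion.2 ⟨r, hr, hp.mem_atoms⟩
    rw [hI] at hQ
    have := eq_empty_of_mem_sols hT.niceTree hb hQ
    rwa [this] at hQ

end Correctness

/-! ### Counting projections -/

section Projection

/-! ### Inclusion-exclusion -/

section InclusionExclusion

variable {κ β : Type*} [DecidableEq β]

/-- The intersection of the sets `S i` for `i ∈ X`, if `X` is not empty. -/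
def common (X : Finset κ) (S : κ → Finset β) : Finset β :=
  (X.biUnion S).filter fun q => ∀ i ∈ X, q ∈ S i

theorem mem_common {X : Finset κ} (hX : X.Nonempty) {S : κ → Finset β} {q : β} :
    q ∈ common X S ↔ ∀ i ∈ X, q ∈ S i := by
  obtain ⟨i, hi⟩ := hX
  simp only [common, Finset.mem_filter, Finset.mem_biUnion, and_iff_right_iff_imp]
  exact fun h => ⟨i, hi, h i hi⟩

theorem card_biUnion_eq_sum_common [DecidableEq κ] (X : Finset κ) (S : κ → Finset β) :
    ((X.biUnion S).card : ℤ) =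
      ∑ Y ∈ X.powerset.erase ∅, (-1) ^ (Y.card - 1) * ((common Y S).card : ℤ) := by
  rw [Finset.inclusion_exclusion_card_biUnion]
  have h1 : X.powerset.filter (·.Nonempty) = X.powerset.erase ∅ := by
    ext Y
    simp [Finset.nonempty_iff_ne_empty, and_comm]
  rw [← h1, ← Finset.sum_coe_sort (X.powerset.filter (·.Nonempty)) fun Y =>
    (-1) ^ (Y.card - 1) * ((common Y S).card : ℤ)]
  refine Finset.sum_congr rfl fun Y _ => ?_
  have hY := (Finset.mem_filter.1 Y.2).2
  have h2 : Y.1.inf' hY S = common Y.1 S := by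
    ext q
    rw [mem_common hY, Finset.mem_inf']
  -- The two sign conventions differ by an even exponent; `Y` is nonempty, so the subtraction is not
  -- truncated.
  have h3 : Y.1.card + 1 = (Y.1.card - 1) + 2 := by
    have := hY.card_pos
    omega
  rw [h2, h3, pow_add]
  simp

end InclusionExclusion

/-! ### The stored counts as sizes of unions and intersections -/

variable {α ι : Type*} [DecidableEq α]

/-- In the applications `F o` is the set of projections that arise through the origin `o`. -/
theorem pmc_eq_card {prog : Program α} {t : TTree α (Table α)} {πs : List (ProjTable α)}
    {ρ : Table α} {F : List (Row α) → Finset (Finset α)}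
    (h : ∀ O ⊆ origs prog t ρ, O.Nonempty → sipmcSeq πs O = (common O F).card) :
    pmc prog t πs ρ = (((origs prog t ρ).biUnion F).card : ℤ) := by
  rw [pmc, card_biUnion_eq_sum_common]
  refine Finset.sum_congr rfl fun O hO => ?_
  rw [Finset.mem_erase, Finset.mem_powerset] at hO
  rw [h O hO.2 (Finset.nonempty_iff_ne_empty.2 hO.1)]

/-- In the inclusion-exclusion formula for the union over `ρ`, the recursive sum cancels the terms
of all proper subsets. What remains is the intersection over `ρ` up to sign, which the absolute
value removes. -/
theorem ipmc_eq_card {prog : Program α} {t : TTree α (Table α)} {πs : List (ProjTable α)}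
    {S : Row α → Finset (Finset α)} (ht : t.children.isEmpty = false) (ρ : Table α)
    (hρ : ρ.Nonempty)
    (h : ∀ φ ⊆ ρ, φ.Nonempty → pmc prog t πs φ = ((φ.biUnion S).card : ℤ)) :
    ipmc prog t πs ρ = (common ρ S).card := by
  induction ρ using Finset.strongInduction with
  | H ρ ih =>
    rw [ipmc, if_neg (by simp [ht]), h ρ (Finset.Subset.refl _) hρ,
      Finset.sum_attach _ fun φ => (-1) ^ φ.card * (ipmc prog t πs φ : ℤ),
      card_biUnion_eq_sum_common]
    have h1 : ρ ∈ ρ.powerset.erase ∅ :=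
      Finset.mem_erase.2 ⟨hρ.ne_empty, Finset.mem_powerset_self ρ⟩
    have h2 : (ρ.powerset.erase ∅).erase ρ = ρ.ssubsets.erase ∅ := by
      rw [Finset.ssubsets, Finset.erase_right_comm]
    rw [← Finset.add_sum_erase _ _ h1, h2, add_assoc, ← Finset.sum_add_distrib,
      Finset.sum_eq_zero, add_zero, Int.natAbs_mul, Int.natAbs_pow]
    · simp
    · intro φ hφ
      rw [Finset.mem_erase, Finset.mem_ssubsets] at hφ
      have hne := Finset.nonempty_iff_ne_empty.2 hφ.1
      rw [ih φ hφ.2 hne fun ψ hψ => h ψ (hψ.trans hφ.2.subset)]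
      obtain ⟨k, hk⟩ : ∃ k, φ.card = k + 1 := ⟨φ.card - 1, by have := hne.card_pos; omega⟩
      rw [hk, Nat.add_sub_cancel, pow_succ]
      ring

theorem mem_subBuckets {P : Finset α} {ν ρ : Table α} :
    ρ ∈ subBuckets P ν ↔
      ρ.Nonempty ∧ ρ ⊆ ν ∧ ∀ u ∈ ρ, ∀ v ∈ ρ, u.interp ∩ P = v.interp ∩ P := by
  simp only [subBuckets, buckets, Finset.mem_biUnion, Finset.mem_image, Finset.mem_erase,
    Finset.mem_powerset, exists_exists_and_eq_and, ← Finset.nonempty_iff_ne_empty]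
  constructor
  · rintro ⟨w, -, hne, hsub⟩
    refine ⟨hne, hsub.trans (Finset.filter_subset _ _), fun u hu v hv => ?_⟩
    rw [(Finset.mem_filter.1 (hsub hu)).2, (Finset.mem_filter.1 (hsub hv)).2]
  · rintro ⟨⟨u, hu⟩, hsub, h⟩
    exact ⟨u, hsub hu, ⟨u, hu⟩, fun v hv => Finset.mem_filter.2 ⟨hsub hv, h v hv u hu⟩⟩

theorem sipmc_proj {prog : Program α} {P : Finset α} {t : TTree α (Table α)}
    {πs : List (ProjTable α)} {ρ : Table α} :
    sipmc (proj prog P t πs) ρ = if ρ ∈ subBuckets P t.tab then ipmc prog t πs ρ else 0 := by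
  rw [sipmc, proj, Finset.filter_image, Finset.sum_image fun x _ y _ h => congrArg Prod.fst h]
  rw [Finset.filter_eq']
  split_ifs <;> simp

theorem mem_nthRows {O : Finset (List (Row α))} {i : ℕ} {s : Row α} :
    s ∈ nthRows O i ↔ ∃ o ∈ O, o[i]? = some s := by
  simp [nthRows]

theorem mem_origs {prog : Program α} {t : TTree α (Table α)} {ρ : Table α} {o : List (Row α)} :
    o ∈ origs prog t ρ ↔ ∃ u ∈ ρ, o ∈ orig prog t u := by
  simp [origs]

theorem mem_orig_unary {prog : Program α} {b : Finset α} {τ : Table α} {c : TTree α (Table α)}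
    {u : Row α} {o : List (Row α)} :
    o ∈ orig prog (.unary b τ c) u ↔
      ∃ s ∈ c.tab, o = [s] ∧ u ∈ phc prog (.unary b τ c) [{s}] := by
  simp only [orig, TTree.children, List.map, rowSeqs, Finset.mem_filter, Finset.mem_image,
    Finset.mem_product, Finset.mem_singleton, Prod.exists]
  constructor
  · rintro ⟨⟨s, _, ⟨hs, rfl⟩, rfl⟩, h⟩
    exact ⟨s, hs, rfl, h⟩
  · rintro ⟨s, hs, rfl, h⟩
    exact ⟨⟨s, [], ⟨hs, rfl⟩, rfl⟩, h⟩

theorem mem_orig_binary {prog : Program α} {b : Finset α} {τ : Table α}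
    {l r : TTree α (Table α)} {u : Row α} {o : List (Row α)} :
    o ∈ orig prog (.binary b τ l r) u ↔
      ∃ s₁ ∈ l.tab, ∃ s₂ ∈ r.tab, o = [s₁, s₂] ∧
        u ∈ phc prog (.binary b τ l r) [{s₁}, {s₂}] := by
  simp only [orig, TTree.children, List.map, rowSeqs, Finset.mem_filter, Finset.mem_image,
    Finset.mem_product, Finset.mem_singleton, Prod.exists]
  constructor
  · rintro ⟨⟨s₁, _, ⟨h₁, s₂, _, ⟨h₂, rfl⟩, rfl⟩, rfl⟩, h⟩
    exact ⟨s₁, h₁, s₂, h₂, rfl, h⟩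
  · rintro ⟨s₁, h₁, s₂, h₂, rfl, h⟩
    exact ⟨⟨s₁, [s₂], ⟨h₁, s₂, [], ⟨h₂, rfl⟩, rfl⟩, rfl⟩, h⟩

/-- `phc` reads no stored table and no bag below the children, so origins are the same in the input
tree, the tree of `dpPHC` and the purged tree. -/
theorem phc_unary_congr {ι' : Type*} {prog : Program α} {b : Finset α} {x : ι} {y : ι'}
    {c : TTree α ι} {d : TTree α ι'} (h : c.bag = d.bag) (τ : Table α) :
    phc prog (.unary b x c) [τ] = phc prog (.unary b y d) [τ] := by
  simp only [phc, h]

theorem phc_binary_congr {ι' : Type*} {prog : Program α} {b : Finset α} {x : ι} {y : ι'}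
    {l r : TTree α ι} {l' r' : TTree α ι'} (hl : l.bag = l'.bag) (hr : r.bag = r'.bag)
    (τ₁ τ₂ : Table α) :
    phc prog (.binary b x l r) [τ₁, τ₂] = phc prog (.binary b y l' r') [τ₁, τ₂] := by
  simp only [phc, hl, hr]

theorem dpPHC_bag (prog : Program α) (T : TTree α ι) : (dpPHC prog T).bag = T.bag := by
  cases T <;> rfl

theorem purgeFrom_bag (prog : Program α) (T : TTree α (Table α)) (ν : Table α) :
    (purgeFrom prog T ν).bag = T.bag := by
  cases T <;> rfl

theorem purgeFrom_tab (prog : Program α) (T : TTree α (Table α)) (ν : Table α) :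
    (purgeFrom prog T ν).tab = ν := by
  cases T <;> rfl

open Classical in
/-- The projections of the interpretations that give rise to the row `u` of the root. -/
noncomputable def projs (prog : Program α) (P : Finset α) (T : TTree α ι) (u : Row α) :
    Finset (Finset α) :=
  P.powerset.filter fun Q => ∃ I ∈ sols prog T u, I ∩ P = Q

theorem mem_projs {prog : Program α} {P : Finset α} {T : TTree α ι} {u : Row α}
    {Q : Finset α} : Q ∈ projs prog P T u ↔ ∃ I ∈ sols prog T u, I ∩ P = Q := by
  simp only [projs, Finset.mem_filter, Finset.mem_powerset, and_iff_right_iff_imp]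
  rintro ⟨I, -, rfl⟩
  exact Finset.inter_subset_right

/-- A common projection `Q` forces `u.interp ∩ P = Q ∩ T.bag` for all rows. This justifies the
default value `0` for sets of origins that mix classes, which occur when a removed atom lies in `P`.
-/
theorem common_projs_eq_empty {prog : Program α} {P : Finset α} {T : TTree α ι}
    (hT : T.NiceTree) {ρ : Table α} (hρ : ρ.Nonempty)
    (h : ¬ ∀ u ∈ ρ, ∀ v ∈ ρ, u.interp ∩ P = v.interp ∩ P) :
    common ρ (projs prog P T) = ∅ := by
  rw [Finset.eq_empty_iff_forall_notMem]
  intro Q hQ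
  rw [mem_common hρ] at hQ
  have key : ∀ u ∈ ρ, u.interp ∩ P = Q ∩ T.bag := by
    intro u hu
    obtain ⟨I, hI, rfl⟩ := mem_projs.1 (hQ u hu)
    rw [(sols_spec hT hI).2, Finset.inter_right_comm]
  exact h fun u hu v hv => (key u hu).trans (key v hv).symm

/-- The intersection counts stored after purging from `ν` are the numbers of common projections. -/
def CountsCommon (prog : Program α) (P : Finset α) (T : TTree α ι) : Prop :=
  ∀ ν ⊆ (dpPHC prog T).tab, ∀ ρ ⊆ ν, ρ.Nonempty →
    sipmc (dpPROJ prog P (purgeFrom prog (dpPHC prog T) ν)).tab ρ =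
      (common ρ (projs prog P T)).card

theorem sipmc_proj_eq_card {prog : Program α} {P : Finset α} {T : TTree α ι}
    (hT : T.NiceTree) {t : TTree α (Table α)} {πs : List (ProjTable α)} {ρ : Table α}
    (hρ : ρ ⊆ t.tab) (hne : ρ.Nonempty)
    (h : (∀ u ∈ ρ, ∀ v ∈ ρ, u.interp ∩ P = v.interp ∩ P) →
      ipmc prog t πs ρ = (common ρ (projs prog P T)).card) :
    sipmc (proj prog P t πs) ρ = (common ρ (projs prog P T)).card := by
  rw [sipmc_proj]
  split_ifs with hb
  · exact h (mem_subBuckets.1 hb).2.2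
  · rw [common_projs_eq_empty hT hne fun h' => hb (mem_subBuckets.2 ⟨hne, hρ, h'⟩),
      Finset.card_empty]

/-- The rows of one class share `K = u.interp ∩ P`, so this node turns a projection `Q` of the child
into `Q ∪ K`. The map `g` undoes this; by injectivity, intersections and their sizes carry over from
the child. -/
theorem countsCommon_unary {prog : Program α} {P : Finset α} {b : Finset α} {x : ι}
    {c : TTree α ι} (hT : (TTree.unary b x c).NiceTree) (hc : c.NiceTree)
    (g : Finset α → Finset α)
    (hg : ∀ u s, u ∈ phc prog (.unary b x c) [{s}] → ∀ I ∈ sols prog c s,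
      g ((I ∪ u.interp) ∩ P) = I ∩ P)
    (ih : CountsCommon prog P c) : CountsCommon prog P (TTree.unary b x c) := by
  intro ν hν ρ hρ hne
  set νc := nthRows (origs prog (.unary b (phc prog (.unary b x c) [(dpPHC prog c).tab])
    (dpPHC prog c)) ν) 0 with hνc
  set C := purgeFrom prog (dpPHC prog c) νc with hC
  change sipmc (proj prog P (.unary b ν C) [(dpPROJ prog P C).tab]) ρ = _
  have hCtab : C.tab = νc := purgeFrom_tab _ _ _
  have hphc : ∀ s : Row α, phc prog (.unary b ν C) [{s}] = phc prog (.unary b x c) [{s}] :=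
    fun s => phc_unary_congr ((purgeFrom_bag _ _ _).trans (dpPHC_bag _ _)) _
  -- Purging keeps all origins of rows in `ν`, so no contribution to their counts is lost.
  have hmem : ∀ s, s ∈ νc ↔ s ∈ (dpPHC prog c).tab ∧
      ∃ u ∈ ν, u ∈ phc prog (.unary b x c) [{s}] := by
    intro s
    rw [hνc, mem_nthRows]
    constructor
    · rintro ⟨o, ho, hs⟩
      obtain ⟨u, hu, ho⟩ := mem_origs.1 ho
      obtain ⟨s', hs', rfl, h⟩ := mem_orig_unary.1 ho
      obtain rfl : s' = s := by simpa using hs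
      exact ⟨hs', u, hu, by rwa [phc_unary_congr (dpPHC_bag prog c)] at h⟩
    · rintro ⟨hs, u, hu, h⟩
      refine ⟨[s], mem_origs.2 ⟨u, hu, mem_orig_unary.2 ⟨s, hs, rfl, ?_⟩⟩, rfl⟩
      rwa [phc_unary_congr (dpPHC_bag prog c)]
  have hνsub : νc ⊆ (dpPHC prog c).tab := fun s hs => ((hmem s).1 hs).1
  have horig : ∀ φ o, o ∈ origs prog (.unary b ν C) φ ↔
      ∃ u ∈ φ, ∃ s ∈ νc, o = [s] ∧ u ∈ phc prog (.unary b x c) [{s}] := by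
    intro φ o
    simp only [mem_origs, mem_orig_unary, hCtab, hphc]
  refine sipmc_proj_eq_card hT hρ hne fun hbucket => ipmc_eq_card rfl ρ hne fun φ hφ hφne => ?_
  obtain ⟨u₀, hu₀⟩ := hφne
  set K := u₀.interp ∩ P with hK
  have hKu : ∀ u ∈ φ, u.interp ∩ P = K := fun u hu => hbucket u (hφ hu) u₀ (hφ hu₀)
  let F : List (Row α) → Finset (Finset α) := fun o =>
    match o with
    | [s] => (projs prog P c s).image (· ∪ K)
    | _ => ∅
  have hunion : (origs prog (.unary b ν C) φ).biUnion F =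
      φ.biUnion (projs prog P (.unary b x c)) := by
    ext Q
    simp only [Finset.mem_biUnion, horig, mem_projs]
    constructor
    · rintro ⟨_, ⟨u, hu, s, hs, rfl, hus⟩, hQ⟩
      obtain ⟨Q', hQ', rfl⟩ := Finset.mem_image.1 hQ
      obtain ⟨I, hI, rfl⟩ := mem_projs.1 hQ'
      refine ⟨u, hu, I ∪ u.interp, ⟨s, hus, I, hI, rfl⟩, ?_⟩
      rw [Finset.union_inter_distrib_right, hKu u hu]
    · rintro ⟨u, hu, _, ⟨s, hus, I, hI, rfl⟩, rfl⟩
      refine ⟨[s], ⟨u, hu, s, (hmem s).2 ⟨(mem_dpPHC_tab hc).2 ⟨I, hI⟩, u, hρ (hφ hu), hus⟩,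
        rfl, hus⟩, Finset.mem_image.2 ⟨I ∩ P, mem_projs.2 ⟨I, hI, rfl⟩, ?_⟩⟩
      rw [Finset.union_inter_distrib_right, hKu u hu]
  rw [← hunion]
  refine pmc_eq_card fun O hO hOne => ?_
  have hOmem : ∀ o ∈ O, ∃ s ∈ νc, o = [s] ∧ ∃ u ∈ φ, u ∈ phc prog (.unary b x c) [{s}] := by
    intro o ho
    obtain ⟨u, hu, s, hs, rfl, h⟩ := (horig φ o).1 (hO ho)
    exact ⟨s, hs, rfl, u, hu, h⟩
  have hnth : ∀ s, s ∈ nthRows O 0 ↔ [s] ∈ O := by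
    intro s
    rw [mem_nthRows]
    constructor
    · rintro ⟨o, ho, hs⟩
      obtain ⟨s', -, rfl, -⟩ := hOmem o ho
      obtain rfl : s' = s := by simpa using hs
      exact ho
    · exact fun h => ⟨[s], h, rfl⟩
  have hsub : nthRows O 0 ⊆ νc := by
    intro s hs
    obtain ⟨s', hs', he, -⟩ := hOmem _ ((hnth s).1 hs)
    obtain rfl : s = s' := by simpa using he
    exact hs'
  have hne' : (nthRows O 0).Nonempty := by
    obtain ⟨o, ho⟩ := hOne
    obtain ⟨s, -, rfl, -⟩ := hOmem o ho
    exact ⟨s, (hnth s).2 ho⟩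
  have hinv : ∀ s, [s] ∈ O → ∀ Q ∈ projs prog P c s, g (Q ∪ K) = Q := by
    intro s hs Q hQ
    obtain ⟨s', -, he, u, hu, hus⟩ := hOmem _ hs
    obtain rfl : s = s' := by simpa using he
    obtain ⟨I, hI, rfl⟩ := mem_projs.1 hQ
    rw [← hKu u hu, ← Finset.union_inter_distrib_right]
    exact hg u s hus I hI
  have hcommon : common O F = (common (nthRows O 0) (projs prog P c)).image (· ∪ K) := by
    ext Q
    rw [mem_common hOne, Finset.mem_image]
    constructor
    · intro hQ
      obtain ⟨s₀, hs₀⟩ := hne'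
      obtain ⟨Q₀, hQ₀, rfl⟩ := Finset.mem_image.1 (hQ [s₀] ((hnth s₀).1 hs₀))
      refine ⟨Q₀, (mem_common ⟨s₀, hs₀⟩).2 fun s hs => ?_, rfl⟩
      obtain ⟨Q₁, hQ₁, he⟩ := Finset.mem_image.1 (hQ [s] ((hnth s).1 hs))
      have h1 := hinv s₀ ((hnth s₀).1 hs₀) Q₀ hQ₀
      have h2 := hinv s ((hnth s).1 hs) Q₁ hQ₁
      rw [he, h1] at h2
      exact h2 ▸ hQ₁
    · rintro ⟨Q', hQ', rfl⟩ o ho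
      obtain ⟨s, -, rfl, -⟩ := hOmem o ho
      exact Finset.mem_image.2 ⟨Q', (mem_common hne').1 hQ' s ((hnth s).2 ho), rfl⟩
  rw [hcommon, Finset.card_image_of_injOn, ← ih νc hνsub _ hsub hne']
  · simp [sipmcSeq, hC]
  · obtain ⟨s₀, hs₀⟩ := hne'
    intro Q₁ h₁ Q₂ h₂ he
    have h₁ := hinv s₀ ((hnth s₀).1 hs₀) Q₁ ((mem_common ⟨s₀, hs₀⟩).1 h₁ s₀ hs₀)
    have h₂ := hinv s₀ ((hnth s₀).1 hs₀) Q₂ ((mem_common ⟨s₀, hs₀⟩).1 h₂ s₀ hs₀)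
    rw [← h₁, ← h₂]
    exact congrArg g he

/-- By `g₁` and `g₂`, a projection splits into its two parts in the same way for every origin. Hence
an intersection over `O` is the product of the intersections over its coordinates, even if `O`
itself is not a product. -/
theorem countsCommon_binary {prog : Program α} {P : Finset α} {b : Finset α} {x : ι}
    {l r : TTree α ι} (hT : (TTree.binary b x l r).NiceTree) (hl : l.NiceTree) (hr : r.NiceTree)
    (g₁ g₂ : Finset α → Finset α)
    (hg : ∀ u s₁ s₂, u ∈ phc prog (.binary b x l r) [{s₁}, {s₂}] →
      ∀ I₁ ∈ sols prog l s₁, ∀ I₂ ∈ sols prog r s₂,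
        g₁ ((I₁ ∪ I₂) ∩ P) = I₁ ∩ P ∧ g₂ ((I₁ ∪ I₂) ∩ P) = I₂ ∩ P)
    (ihl : CountsCommon prog P l) (ihr : CountsCommon prog P r) :
    CountsCommon prog P (TTree.binary b x l r) := by
  intro ν hν ρ hρ hne
  set O₀ := origs prog (.binary b (phc prog (.binary b x l r)
    [(dpPHC prog l).tab, (dpPHC prog r).tab]) (dpPHC prog l) (dpPHC prog r)) ν with hO₀
  set L := purgeFrom prog (dpPHC prog l) (nthRows O₀ 0) with hL
  set R := purgeFrom prog (dpPHC prog r) (nthRows O₀ 1) with hR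
  change sipmc (proj prog P (.binary b ν L R) [(dpPROJ prog P L).tab, (dpPROJ prog P R).tab]) ρ = _
  have hLtab : L.tab = nthRows O₀ 0 := purgeFrom_tab _ _ _
  have hRtab : R.tab = nthRows O₀ 1 := purgeFrom_tab _ _ _
  have hphc : ∀ s₁ s₂ : Row α, phc prog (.binary b ν L R) [{s₁}, {s₂}] =
      phc prog (.binary b x l r) [{s₁}, {s₂}] := fun s₁ s₂ =>
    phc_binary_congr ((purgeFrom_bag _ _ _).trans (dpPHC_bag _ _))
      ((purgeFrom_bag _ _ _).trans (dpPHC_bag _ _)) _ _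
  have hO₀mem : ∀ o, o ∈ O₀ ↔ ∃ u ∈ ν, ∃ s₁ ∈ (dpPHC prog l).tab, ∃ s₂ ∈ (dpPHC prog r).tab,
      o = [s₁, s₂] ∧ u ∈ phc prog (.binary b x l r) [{s₁}, {s₂}] := by
    intro o
    simp only [hO₀, mem_origs, mem_orig_binary,
      phc_binary_congr (x := phc prog (.binary b x l r) [(dpPHC prog l).tab, (dpPHC prog r).tab])
        (y := x) (dpPHC_bag prog l) (dpPHC_bag prog r)]
  have hsub₁ : nthRows O₀ 0 ⊆ (dpPHC prog l).tab := by
    intro s hs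
    obtain ⟨o, ho, hos⟩ := mem_nthRows.1 hs
    obtain ⟨-, -, s₁, h₁, s₂, -, rfl, -⟩ := (hO₀mem o).1 ho
    obtain rfl : s₁ = s := by simpa using hos
    exact h₁
  have hsub₂ : nthRows O₀ 1 ⊆ (dpPHC prog r).tab := by
    intro s hs
    obtain ⟨o, ho, hos⟩ := mem_nthRows.1 hs
    obtain ⟨-, -, s₁, -, s₂, h₂, rfl, -⟩ := (hO₀mem o).1 ho
    obtain rfl : s₂ = s := by simpa using hos
    exact h₂
  have horig : ∀ φ o, o ∈ origs prog (.binary b ν L R) φ ↔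
      ∃ u ∈ φ, ∃ s₁ ∈ nthRows O₀ 0, ∃ s₂ ∈ nthRows O₀ 1, o = [s₁, s₂] ∧
        u ∈ phc prog (.binary b x l r) [{s₁}, {s₂}] := by
    intro φ o
    simp only [mem_origs, mem_orig_binary, hLtab, hRtab, hphc]
  refine sipmc_proj_eq_card hT hρ hne fun _ => ipmc_eq_card rfl ρ hne fun φ hφ _ => ?_
  let F : List (Row α) → Finset (Finset α) := fun o =>
    match o with
    | [s₁, s₂] => (projs prog P l s₁ ×ˢ projs prog P r s₂).image fun q => q.1 ∪ q.2
    | _ => ∅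
  have hunion : (origs prog (.binary b ν L R) φ).biUnion F =
      φ.biUnion (projs prog P (.binary b x l r)) := by
    ext Q
    simp only [Finset.mem_biUnion, horig, mem_projs]
    constructor
    · rintro ⟨_, ⟨u, hu, s₁, h₁, s₂, h₂, rfl, hus⟩, hQ⟩
      obtain ⟨⟨Q₁, Q₂⟩, hQ', rfl⟩ := Finset.mem_image.1 hQ
      obtain ⟨hQ₁, hQ₂⟩ := Finset.mem_product.1 hQ'
      obtain ⟨I₁, hI₁, rfl⟩ := mem_projs.1 hQ₁
      obtain ⟨I₂, hI₂, rfl⟩ := mem_projs.1 hQ₂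
      exact ⟨u, hu, I₁ ∪ I₂, ⟨s₁, s₂, hus, I₁, hI₁, I₂, hI₂, rfl⟩,
        Finset.union_inter_distrib_right _ _ _⟩
    · rintro ⟨u, hu, _, ⟨s₁, s₂, hus, I₁, hI₁, I₂, hI₂, rfl⟩, rfl⟩
      have ho : [s₁, s₂] ∈ O₀ := (hO₀mem _).2 ⟨u, hρ (hφ hu), s₁, (mem_dpPHC_tab hl).2 ⟨I₁, hI₁⟩,
        s₂, (mem_dpPHC_tab hr).2 ⟨I₂, hI₂⟩, rfl, hus⟩
      exact ⟨[s₁, s₂], ⟨u, hu, s₁, mem_nthRows.2 ⟨_, ho, rfl⟩, s₂, mem_nthRows.2 ⟨_, ho, rfl⟩,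
        rfl, hus⟩, Finset.mem_image.2 ⟨(I₁ ∩ P, I₂ ∩ P), Finset.mem_product.2
          ⟨mem_projs.2 ⟨I₁, hI₁, rfl⟩, mem_projs.2 ⟨I₂, hI₂, rfl⟩⟩,
          (Finset.union_inter_distrib_right _ _ _).symm⟩⟩
  rw [← hunion]
  refine pmc_eq_card fun O hO hOne => ?_
  have hOmem : ∀ o ∈ O, ∃ s₁ ∈ nthRows O₀ 0, ∃ s₂ ∈ nthRows O₀ 1, o = [s₁, s₂] ∧
      ∃ u, u ∈ phc prog (.binary b x l r) [{s₁}, {s₂}] := by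
    intro o ho
    obtain ⟨u, hu, s₁, h₁, s₂, h₂, rfl, h⟩ := (horig φ o).1 (hO ho)
    exact ⟨s₁, h₁, s₂, h₂, rfl, u, h⟩
  have hnth₁ : ∀ s₁, s₁ ∈ nthRows O 0 ↔ ∃ s₂, [s₁, s₂] ∈ O := by
    intro s
    rw [mem_nthRows]
    constructor
    · rintro ⟨o, ho, hs⟩
      obtain ⟨s₁, -, s₂, -, rfl, -⟩ := hOmem o ho
      obtain rfl : s₁ = s := by simpa using hs
      exact ⟨s₂, ho⟩
    · exact fun ⟨s₂, h⟩ => ⟨_, h, rfl⟩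
  have hnth₂ : ∀ s₂, s₂ ∈ nthRows O 1 ↔ ∃ s₁, [s₁, s₂] ∈ O := by
    intro s
    rw [mem_nthRows]
    constructor
    · rintro ⟨o, ho, hs⟩
      obtain ⟨s₁, -, s₂, -, rfl, -⟩ := hOmem o ho
      obtain rfl : s₂ = s := by simpa using hs
      exact ⟨s₁, ho⟩
    · exact fun ⟨s₁, h⟩ => ⟨_, h, rfl⟩
  have hmemO : ∀ s₁ s₂, [s₁, s₂] ∈ O → s₁ ∈ nthRows O₀ 0 ∧ s₂ ∈ nthRows O₀ 1 ∧
      ∃ u, u ∈ phc prog (.binary b x l r) [{s₁}, {s₂}] := by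
    intro s₁ s₂ h
    obtain ⟨t₁, h₁, t₂, h₂, he, hu⟩ := hOmem _ h
    obtain ⟨rfl, rfl⟩ : s₁ = t₁ ∧ s₂ = t₂ := by simpa using he
    exact ⟨h₁, h₂, hu⟩
  obtain ⟨s₁, s₂, hs⟩ : ∃ s₁ s₂, [s₁, s₂] ∈ O := by
    obtain ⟨o, ho⟩ := hOne
    obtain ⟨s₁, -, s₂, -, rfl, -⟩ := hOmem o ho
    exact ⟨s₁, s₂, ho⟩
  have hne₁ : (nthRows O 0).Nonempty := ⟨s₁, (hnth₁ s₁).2 ⟨s₂, hs⟩⟩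
  have hne₂ : (nthRows O 1).Nonempty := ⟨s₂, (hnth₂ s₂).2 ⟨s₁, hs⟩⟩
  have hOsub₁ : nthRows O 0 ⊆ nthRows O₀ 0 := fun t ht => by
    obtain ⟨t', h⟩ := (hnth₁ t).1 ht
    exact (hmemO t t' h).1
  have hOsub₂ : nthRows O 1 ⊆ nthRows O₀ 1 := fun t ht => by
    obtain ⟨t', h⟩ := (hnth₂ t).1 ht
    exact (hmemO t' t h).2.1
  have hinv : ∀ t₁ t₂, [t₁, t₂] ∈ O → ∀ Q₁ ∈ projs prog P l t₁, ∀ Q₂ ∈ projs prog P r t₂,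
      g₁ (Q₁ ∪ Q₂) = Q₁ ∧ g₂ (Q₁ ∪ Q₂) = Q₂ := by
    intro t₁ t₂ ht Q₁ hQ₁ Q₂ hQ₂
    obtain ⟨-, -, u, hu⟩ := hmemO t₁ t₂ ht
    obtain ⟨I₁, hI₁, rfl⟩ := mem_projs.1 hQ₁
    obtain ⟨I₂, hI₂, rfl⟩ := mem_projs.1 hQ₂
    rw [← Finset.union_inter_distrib_right]
    exact hg u t₁ t₂ hu I₁ hI₁ I₂ hI₂
  have hcommon : common O F = (common (nthRows O 0) (projs prog P l) ×ˢ
      common (nthRows O 1) (projs prog P r)).image fun q => q.1 ∪ q.2 := by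
    ext Q
    rw [mem_common hOne, Finset.mem_image]
    constructor
    · intro hQ
      have hdec : ∀ t₁ t₂, [t₁, t₂] ∈ O → g₁ Q ∈ projs prog P l t₁ ∧ g₂ Q ∈ projs prog P r t₂ ∧
          g₁ Q ∪ g₂ Q = Q := by
        intro t₁ t₂ ht
        obtain ⟨⟨Q₁, Q₂⟩, hQ', rfl⟩ := Finset.mem_image.1 (hQ _ ht)
        obtain ⟨hQ₁, hQ₂⟩ := Finset.mem_product.1 hQ'
        obtain ⟨e₁, e₂⟩ := hinv t₁ t₂ ht Q₁ hQ₁ Q₂ hQ₂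
        simp only [e₁, e₂]
        exact ⟨hQ₁, hQ₂, trivial⟩
      refine ⟨(g₁ Q, g₂ Q), Finset.mem_product.2 ⟨(mem_common hne₁).2 fun t ht => ?_,
        (mem_common hne₂).2 fun t ht => ?_⟩, (hdec s₁ s₂ hs).2.2⟩
      · obtain ⟨t', h⟩ := (hnth₁ t).1 ht
        exact (hdec t t' h).1
      · obtain ⟨t', h⟩ := (hnth₂ t).1 ht
        exact (hdec t' t h).2.1
    · rintro ⟨⟨Q₁, Q₂⟩, hQ, rfl⟩ o ho
      obtain ⟨hQ₁, hQ₂⟩ := Finset.mem_product.1 hQ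
      obtain ⟨t₁, -, t₂, -, rfl, -⟩ := hOmem o ho
      exact Finset.mem_image.2 ⟨(Q₁, Q₂), Finset.mem_product.2
        ⟨(mem_common hne₁).1 hQ₁ t₁ ((hnth₁ t₁).2 ⟨t₂, ho⟩),
          (mem_common hne₂).1 hQ₂ t₂ ((hnth₂ t₂).2 ⟨t₁, ho⟩)⟩, rfl⟩
  rw [hcommon, Finset.card_image_of_injOn, Finset.card_product, ← ihl _ hsub₁ _ hOsub₁ hne₁,
    ← ihr _ hsub₂ _ hOsub₂ hne₂]
  · simp [sipmcSeq, hL, hR, Finset.prod_range_succ]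
  · rintro ⟨Q₁, Q₂⟩ h ⟨Q₁', Q₂'⟩ h' he
    obtain ⟨h₁, h₂⟩ := Finset.mem_product.1 (Finset.mem_coe.1 h)
    obtain ⟨h₁', h₂'⟩ := Finset.mem_product.1 (Finset.mem_coe.1 h')
    have hm₁ := (hnth₁ s₁).2 ⟨s₂, hs⟩
    have hm₂ := (hnth₂ s₂).2 ⟨s₁, hs⟩
    obtain ⟨e₁, e₂⟩ := hinv s₁ s₂ hs Q₁ ((mem_common hne₁).1 h₁ s₁ hm₁) Q₂
      ((mem_common hne₂).1 h₂ s₂ hm₂)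
    obtain ⟨e₁', e₂'⟩ := hinv s₁ s₂ hs Q₁' ((mem_common hne₁).1 h₁' s₁ hm₁) Q₂'
      ((mem_common hne₂).1 h₂' s₂ hm₂)
    have he : Q₁ ∪ Q₂ = Q₁' ∪ Q₂' := he
    rw [Prod.mk.injEq]
    exact ⟨by rw [← e₁, he, e₁'], by rw [← e₂, he, e₂']⟩

theorem TTree.NiceTree.countsCommon {prog : Program α} {P : Finset α} {T : TTree α ι}
    (hT : T.NiceTree) : CountsCommon prog P T := by
  induction hT with
  | leaf x =>
    intro ν hν ρ hρ hne
    change sipmc (proj prog P (.leaf ∅ ν) []) ρ = _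
    refine sipmc_proj_eq_card (.leaf x) hρ hne fun _ => ?_
    have hρ' : ρ = {Row.empty α} :=
      hne.subset_singleton_iff.1 (hρ.trans hν)
    have hc : common ρ (projs prog P (.leaf ∅ x)) = {∅} := by
      ext Q
      rw [mem_common hne, hρ']
      simp [mem_projs, mem_sols_leaf, eq_comm]
    rw [hc, ipmc]
    rfl
  | introduce a x c ha hc ih =>
    have hab : a ∉ c.bag := fun h => ha (c.bag_subset_cover h)
    -- Below this node `a` is never true, and `J` adds nothing else to the solution.
    refine countsCommon_unary (hc.introduce a x c ha) hc (fun Q => Q.erase a) ?_ ih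
    intro u s hus I hI
    obtain ⟨_, hs, J, hJ, -, σ, -, rfl⟩ := (mem_phc_introduce hab).1 hus
    obtain rfl := Finset.mem_singleton.1 hs
    obtain ⟨h1, h2⟩ := sols_spec hc hI
    have haI : a ∉ I := fun h => ha (h1 h)
    ext v
    rcases hJ with rfl | rfl <;>
      simp only [h2, Finset.mem_erase, Finset.mem_inter, Finset.mem_union, Finset.mem_insert] <;>
      grind
  | removal a x c ha hc ih =>
    refine countsCommon_unary (hc.removal a x c ha) hc id ?_ ih
    intro u s hus I hI
    obtain ⟨_, hs, -, rfl⟩ := (mem_phc_removal ha).1 hus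
    obtain rfl := Finset.mem_singleton.1 hs
    obtain ⟨h1, h2⟩ := sols_spec hc hI
    rw [id, Finset.union_eq_left.2]
    rw [h2]
    exact (Finset.erase_subset _ _).trans Finset.inter_subset_left
  | join b x l r hbl hbr hb hlr hl hr ihl ihr =>
    -- An atom of one part that occurs on the other side lies in `b`, where the parts agree; so
    -- intersecting with a cover recovers the part.
    refine countsCommon_binary (.join b x l r hbl hbr hb hlr hl hr) hl hr (· ∩ l.cover)
      (· ∩ r.cover) ?_ ihl ihr
    intro u s₁ s₂ hus I₁ hI₁ I₂ hI₂
    obtain ⟨_, hs₁, _, hs₂, he, -, rfl⟩ := (mem_phc_join hbl hbr hb).1 hus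
    obtain rfl := Finset.mem_singleton.1 hs₁
    obtain rfl := Finset.mem_singleton.1 hs₂
    obtain ⟨h1, h2⟩ := sols_spec hl hI₁
    obtain ⟨h3, h4⟩ := sols_spec hr hI₂
    rw [hbl] at h2
    rw [hbr] at h4
    have hbag : ∀ v ∈ b, v ∈ I₁ ↔ v ∈ I₂ := by
      intro v hv
      have := congrArg (v ∈ ·) (h2.symm.trans (he.trans h4))
      simpa [hv] using this
    constructor
    · ext v
      have e1 := @h1 v
      have e2 := @hlr v
      have e3 := @h3 v
      have e4 := hbag v
      simp only [Finset.mem_inter, Finset.mem_union] at e2 ⊢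
      grind
    · ext v
      have e1 := @h1 v
      have e2 := @hlr v
      have e3 := @h3 v
      have e4 := hbag v
      simp only [Finset.mem_inter, Finset.mem_union] at e2 ⊢
      grind

/-! ### The output -/

theorem mdpPHC_eq_projectedCount {prog : Program α} {P : Finset α} (hcf : HeadCycleFree prog)
    (hne : prog ≠ {Rule.empty α}) {T : TTree α ι} (hT : IsNiceTD prog T) :
    mdpPHC prog P T = projectedCount prog P := by
  have hN := hT.niceTree
  have hset : (fun I => I ∩ P) '' {I | IsAnswerSet prog I} = projs prog P T (Row.empty α) := by
    ext Q
    simp [mem_projs, mem_sols_root_iff hcf hne hT]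
  rw [projectedCount, hset, Set.ncard_coe_finset, mdpPHC, purge]
  have hroot : ∀ u ∈ (dpPHC prog T).tab, u = Row.empty α := fun u hu => by
    obtain ⟨I, hI⟩ := (mem_dpPHC_tab hN).1 hu
    exact eq_empty_of_mem_sols hN hT.2.2 hI
  by_cases hmem : Row.empty α ∈ (dpPHC prog T).tab
  · rw [hN.countsCommon _ (Finset.Subset.refl _) _ (Finset.singleton_subset_iff.2 hmem)
      (Finset.singleton_nonempty _)]
    congr 1
    ext Q
    simp [mem_common]
  · have h1 : projs prog P T (Row.empty α) = ∅ := by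
      rw [Finset.eq_empty_iff_forall_notMem]
      intro Q hQ
      obtain ⟨I, hI, -⟩ := mem_projs.1 hQ
      exact hmem ((mem_dpPHC_tab hN).2 ⟨I, hI⟩)
    have h2 : (dpPHC prog T).tab = ∅ := Finset.eq_empty_iff_forall_notMem.2 fun u hu =>
      hmem (hroot u hu ▸ hu)
    rw [h1, h2, Finset.card_empty]
    -- Without answer sets the root table is empty and nothing is stored there, so the output is the
    -- default `0`.
    have h3 : ∀ t : TTree α (Table α), t.tab = ∅ →
        (dpPROJ prog P t).tab = ∅ := by
      intro t ht
      cases t <;> simp [dpPROJ, TTree.dp, TTree.tab, proj, subBuckets, buckets] at ht ⊢ <;>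
        simp [ht]
    rw [h3 _ (purgeFrom_tab _ _ _)]
    simp [sipmc]

end Projection

end PASP

theorem mainTheorem5 {α : Type*} [DecidableEq α] (prog : PASP.Program α) (P : Finset α)
    (hP : P ⊆ PASP.atoms prog) (hcf : PASP.HeadCycleFree prog)
    (hne : prog ≠ {PASP.Rule.empty α}) :
    (∃ T : PASP.TTree α Unit, PASP.IsNiceTD prog T) ∧
    ∀ T : PASP.TTree α Unit, PASP.IsNiceTD prog T →
      PASP.mdpPHC prog P T = PASP.projectedCount prog P := by
  exact ⟨PASP.exists_isNiceTD prog, fun _ hT => PASP.mdpPHC_eq_projectedCount hcf hne hT⟩
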